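/- Let $M$ be a smooth (real) three-dimensional manifold with a smooth complex-valued metric $g$, i.e. a smooth field of nondegenerate symmetric complex-bilinear forms on $T^{\mathbb C}M=\mathbb C\otimes TM$ (for instance, the complex-bilinear extension of a pseudo-Riemannian metric of any signature). Let $\nabla$ be its Levi-Civita connection, with curvature $R_{abd}{}^{c}V^d=2\nabla_{[a}\nabla_{b]}V^c$, Ricci tensor $R_{ab}=R_{acb}{}^{c}$, Ricci scalar $R=g^{ab}R_{ab}$, $S=\tfrac1{12}R$, tracefree Ricci tensor $\Phi_{ab}=R_{ab}-\tfrac13Rg_{ab}$, Schouten tensor $\mathrm P_{ab}=-\Phi_{ab}-\tfrac1{12}Rg_{ab}$ and Cotton tensor $A_{abc}=2\nabla_{[b}\mathrm P_{c]a}$. Let $\mathcal N\subset T^{\mathbb C}M$ be a null structure, i.e. a smooth complex line subbundle with $g(k,k)=0$ for all $k\in\mathcal N$, and let $\mathcal N^\perp$ be its orthogonal complement. A frame $(k,\ell,n)$ is adapted to $\mathcal N$ if $k$ generates $\mathcal N$ and $g_{ab}=2k_{(a}\ell_{b)}-2n_an_b$. In such a frame, put $$\Phi_0=\tfrac12\Phi_{ab}k^ak^b,\quad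 \Phi_1=\tfrac12\Phi_{ab}k^an^b,\quad \Phi_2=\tfrac12\Phi_{ab}k^a\ell^b,\quad \Phi_3=\tfrac12\Phi_{ab}\ell^an^b,\quad \Phi_4=\tfrac12\Phi_{ab}\ell^a\ell^b .$$ Assume: 1. $\mathcal N$ is a multiple principal null structure: at every point, in an adapted frame, $z=0$ is a multiple root of $\Phi_0+4\Phi_1z+6\Phi_2z^2+4\Phi_3z^3+\Phi_4z^4$ (equivalently, $\Phi_0=\Phi_1=0$); 2. $\Phi_{ab}$ is of type II with respect to $\mathcal N$ and does not degenerate further: at every point $\Phi_2\neq0$ in an adapted frame (so that this root has multiplicity exactly two); 3. at every point, $k^ak^b\left(A_{abc}+3\,g_{bc}\nabla_aS\right)=0$ for a generator $k^a$ of $\mathcal N$. Then $\mathcal N$ is co-geodetic, i.e. $g(\nabla_XY,Z)=0$ for all local smooth sections $X,Y$ of $\mathcal N^\perp$ and $Z$ of $\mathcal N$. In particular, in every smooth local adapted frame the Newman–Penrose coefficients $\kappa=n_bk^a\nabla_ak^b$ and $\rho=n_bn^a\nabla_ak^b$ vanish. -/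

import Mathlib

open scoped Manifold ContDiff TensorProduct

namespace GoldbergSachs

noncomputable section

/-- The model space of real 3-manifolds. -/
abbrev E3 : Type := EuclideanSpace ℝ (Fin 3)

/-! ### Tensor calculus in a coordinate domain

`G : E3 → Matrix (Fin 3) (Fin 3) ℂ` stands for the component functions `g_{ab}` of a complex-valued
metric in a coordinate chart. All index positions below follow the written order of the names. -/

section Coordinates

/-- The partial derivative `∂_a f` at `y`. -/
def pd (a : Fin 3) (f : E3 → ℂ) (y : E3) : ℂ :=
  fderiv ℝ f y (EuclideanSpace.single a 1)

variable (G : E3 → Matrix (Fin 3) (Fin 3) ℂ)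

/-- Christoffel symbol `Γ^c_{ab}` of the Levi-Civita connection,
`½ g^{cd} (∂_a g_{db} + ∂_b g_{da} - ∂_d g_{ab})`. -/
def christoffel (c a b : Fin 3) (y : E3) : ℂ :=
  (1 / 2) * ∑ d, (G y)⁻¹ c d *
    (pd a (fun x => G x d b) y + pd b (fun x => G x d a) y - pd d (fun x => G x a b) y)

/-- Riemann tensor `R_{abd}{}^c`, with the convention
`R_{abd}{}^c V^d = (∇_a ∇_b - ∇_b ∇_a) V^c`. -/
def riemann (a b d c : Fin 3) (y : E3) : ℂ :=
  pd a (christoffel G c b d) y - pd b (christoffel G c a d) y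
    + ∑ f, (christoffel G c a f y * christoffel G f b d y
      - christoffel G c b f y * christoffel G f a d y)

/-- Ricci tensor `R_{ab} = R_{acb}{}^c`. -/
def ricci (a b : Fin 3) (y : E3) : ℂ := ∑ c, riemann G a c b c y

/-- Ricci scalar `R = g^{ab} R_{ab}`. -/
def scalar (y : E3) : ℂ := ∑ a, ∑ b, (G y)⁻¹ a b * ricci G a b y

/-- `S = R / 12`. -/
def scalarS (y : E3) : ℂ := (1 / 12) * scalar G y

/-- Tracefree Ricci tensor `Φ_{ab} = R_{ab} - (1/3) R g_{ab}`. -/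
def tracefreeRicci (a b : Fin 3) (y : E3) : ℂ :=
  ricci G a b y - (1 / 3) * scalar G y * G y a b

/-- Schouten (Rho) tensor `P_{ab} = - Φ_{ab} - (1/12) R g_{ab}`. -/
def schouten (a b : Fin 3) (y : E3) : ℂ :=
  - tracefreeRicci G a b y - (1 / 12) * scalar G y * G y a b

/-- Covariant derivative `∇_b T_{ca}` of a covariant 2-tensor. -/
def covDeriv2 (T : Fin 3 → Fin 3 → E3 → ℂ) (b c a : Fin 3) (y : E3) : ℂ :=
  pd b (T c a) y - ∑ d, christoffel G d b c y * T d a y - ∑ d, christoffel G d b a y * T c d y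

/-- Cotton tensor `A_{abc} = 2 ∇_{[b} P_{c]a} = ∇_b P_{ca} - ∇_c P_{ba}`. -/
def cotton (a b c : Fin 3) (y : E3) : ℂ :=
  covDeriv2 G (schouten G) b c a y - covDeriv2 G (schouten G) c b a y

/-- Component `(∇_X Y)^c = X^a (∂_a Y^c + Γ^c_{ad} Y^d)` of the covariant derivative of a vector
field with components `Y` in the direction of the vector with components `X`. -/
def covDerivVec (X : Fin 3 → ℂ) (Y : Fin 3 → E3 → ℂ) (c : Fin 3) (y : E3) : ℂ :=
  ∑ a, X a * (pd a (Y c) y + ∑ d, christoffel G c a d y * Y d y)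

end Coordinates

/-! ### Complexified tangent spaces, complex-valued metrics and null structures -/

section Manifold

variable {M : Type*} [TopologicalSpace M] [ChartedSpace E3 M]

/-- The complexified tangent space `ℂ ⊗ T_p M`. -/
abbrev CTangent (p : M) : Type := ℂ ⊗[ℝ] TangentSpace 𝓘(ℝ, E3) p

/-- The coordinate vector `∂_i` of the chart `e`, at the point with coordinates `y`. -/
def coordVec (e : OpenPartialHomeomorph M E3) (y : E3) (i : Fin 3) : CTangent (e.symm y) :=
  (1 : ℂ) ⊗ₜ[ℝ] (mfderiv 𝓘(ℝ, E3) 𝓘(ℝ, E3) e.symm y (EuclideanSpace.single i (1 : ℝ) : E3))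

/-- The differential `dx^i` at `p` of the `i`-th coordinate of the chart `e`. -/
def realCoord (e : OpenPartialHomeomorph M E3) (p : M) (i : Fin 3) :
    TangentSpace 𝓘(ℝ, E3) p →ₗ[ℝ] ℝ :=
  ((EuclideanSpace.proj i : E3 →L[ℝ] ℝ) ∘L
    (NormedSpace.fromTangentSpace (𝕜 := ℝ) (e p)).toContinuousLinearMap ∘L
      mfderiv 𝓘(ℝ, E3) 𝓘(ℝ, E3) e p).toLinearMap

/-- The component `v^i` in the chart `e` of a complex tangent vector `v` at `p`:
the complex-linear extension of `dx^i`. -/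
def coord (e : OpenPartialHomeomorph M E3) (p : M) (i : Fin 3) : CTangent p →ₗ[ℂ] ℂ :=
  (TensorProduct.AlgebraTensorModule.rid ℝ ℂ ℂ).toLinearMap ∘ₗ
    (realCoord e p i).baseChange ℂ

/-- The component functions of a complex vector field in the chart `e`. -/
def fieldComp (e : OpenPartialHomeomorph M E3) (V : ∀ p : M, CTangent p) (i : Fin 3) (y : E3) : ℂ :=
  coord e (e.symm y) i (V (e.symm y))

/-- The complex vector field `V` is smooth on the set `U` (used for open `U`). -/
def SmoothFieldOn (U : Set M) (V : ∀ p : M, CTangent p) : Prop :=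
  ∀ e ∈ atlas E3 M, ∀ i, ContDiffOn ℝ ∞ (fieldComp e V i) (e.target ∩ e.symm ⁻¹' U)

variable (M) in
/-- A smooth complex-valued metric on `M`: a smooth field of nondegenerate symmetric
complex-bilinear forms on the complexified tangent spaces. The complex-bilinear extensions of
(pseudo-)Riemannian metrics of any signature are those with real values on real vectors. -/
structure ComplexMetric where
  form : ∀ p : M, LinearMap.BilinForm ℂ (CTangent p)
  symm : ∀ p, (form p).IsSymm
  nondegenerate : ∀ p, (form p).Nondegenerate
  smooth : ∀ e ∈ atlas E3 M, ∀ i j,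
    ContDiffOn ℝ ∞ (fun y => form (e.symm y) (coordVec e y i) (coordVec e y j)) e.target

/-- The matrix of components `g_{ij}` of the metric in the chart `e`. -/
def ComplexMetric.comp (g : ComplexMetric M) (e : OpenPartialHomeomorph M E3) (y : E3) :
    Matrix (Fin 3) (Fin 3) ℂ :=
  Matrix.of fun i j => g.form (e.symm y) (coordVec e y i) (coordVec e y j)

/-- A null structure: a smooth complex line subbundle of the complexified tangent bundle that is
null for the metric. -/
structure NullStructure (g : ComplexMetric M) where
  fiber : ∀ p : M, Submodule ℂ (CTangent p)
  finrank_eq_one : ∀ p, Module.finrank ℂ (fiber p) = 1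
  null : ∀ p, ∀ k ∈ fiber p, g.form p k k = 0
  smooth : ∀ p, ∃ U : Set M, IsOpen U ∧ p ∈ U ∧ ∃ k : ∀ q : M, CTangent q,
    SmoothFieldOn U k ∧ ∀ q ∈ U, k q ∈ fiber q ∧ k q ≠ 0

variable {g : ComplexMetric M}

/-- The fibre at `p` of the orthogonal complement `N^⊥`. -/
def NullStructure.perp (N : NullStructure g) (p : M) : Set (CTangent p) :=
  {v | ∀ k ∈ N.fiber p, g.form p v k = 0}

/-- `(k, l, n)` is a frame of the complexified tangent space at `p` adapted to `N`: `k` generates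
`N_p` and `g_{ab} = 2 k_{(a} l_{b)} - 2 n_a n_b`, i.e. `g(k,l) = 1`, `g(n,n) = -1/2` and all
other products vanish. -/
structure NullStructure.IsAdaptedFrame (N : NullStructure g) (p : M) (k l n : CTangent p) :
    Prop where
  mem : k ∈ N.fiber p
  kk : g.form p k k = 0
  ll : g.form p l l = 0
  kn : g.form p k n = 0
  ln : g.form p l n = 0
  kl : g.form p k l = 1
  nn : g.form p n n = -(1 / 2)

/-- The value `Φ_{ab} v^a w^b` of the tracefree Ricci tensor on complex vectors at `p`, computed in
the chart `e`. -/
def phiForm (g : ComplexMetric M) (e : OpenPartialHomeomorph M E3) (p : M) (v w : CTangent p) : ℂ :=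
  ∑ a, ∑ b, tracefreeRicci (g.comp e) a b (e p) * coord e p a v * coord e p b w

/-- The component `Φ_2 = ½ Φ_{ab} k^a l^b`. -/
def phiTwo (g : ComplexMetric M) (e : OpenPartialHomeomorph M E3) (p : M) (k l : CTangent p) : ℂ :=
  (1 / 2) * phiForm g e p k l

open Polynomial in
/-- The polynomial `Φ_0 + 4 Φ_1 z + 6 Φ_2 z² + 4 Φ_3 z³ + Φ_4 z⁴` attached to a frame `(k, l, n)`,
equal to `½ Φ_{ab} ξ^a ξ^b` with `ξ = k + 2 z n + z² l`. The null line spanned by `k`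
is the value `z = 0`. -/
def ricciPolynomial (g : ComplexMetric M) (e : OpenPartialHomeomorph M E3) (p : M)
    (k l n : CTangent p) : ℂ[X] :=
  C ((1 / 2) * phiForm g e p k k) + C (4 * ((1 / 2) * phiForm g e p k n)) * X
    + C (6 * phiTwo g e p k l) * X ^ 2
    + C (4 * ((1 / 2) * phiForm g e p l n)) * X ^ 3 + C ((1 / 2) * phiForm g e p l l) * X ^ 4

/-- `N` is a multiple principal null structure: at each point, in an adapted frame, the root `z = 0`
(the one that determines `N`) of the Ricci polynomial is multiple. Here and below the conditions
are tensorial, so that they do not depend on the chart; they are required in all charts. -/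
def NullStructure.IsMultiplePrincipal (N : NullStructure g) : Prop :=
  ∀ p : M, ∀ e ∈ atlas E3 M, p ∈ e.source → ∃ k l n : CTangent p, N.IsAdaptedFrame p k l n ∧
    2 ≤ emultiplicity Polynomial.X (ricciPolynomial g e p k l n)

/-- For a multiple principal `N`, this says that `Φ` is of type II with respect to `N` and does
not degenerate further at any point: `Φ_2 ≠ 0` in an adapted frame, so that the multiplicity of
`N` is exactly two. -/
def NullStructure.IsNondegenerateTypeII (N : NullStructure g) : Prop :=
  ∀ p : M, ∀ e ∈ atlas E3 M, p ∈ e.source → ∃ k l n : CTangent p, N.IsAdaptedFrame p k l n ∧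
    phiTwo g e p k l ≠ 0

/-- At each point, some generator `k` of `N_p` satisfies
`k^a k^b (A_{abc} + 3 g_{bc} ∇_a S) = 0`. -/
def NullStructure.SatisfiesTypeIICondition (N : NullStructure g) : Prop :=
  ∀ p : M, ∀ e ∈ atlas E3 M, p ∈ e.source → ∃ k ∈ N.fiber p, k ≠ 0 ∧
    ∀ c, ∑ a, ∑ b, coord e p a k * coord e p b k *
      (cotton (g.comp e) a b c (e p) + 3 * g.comp e (e p) b c * pd a (scalarS (g.comp e)) (e p)) = 0

/-- `g(∇_X Y, Z)` at `p`, for a vector field `Y` and vectors `X`, `Z` at `p`, in the chart `e`. -/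
def metricCovDeriv (g : ComplexMetric M) (e : OpenPartialHomeomorph M E3) (p : M)
    (X : CTangent p) (Y : ∀ q : M, CTangent q) (Z : CTangent p) : ℂ :=
  ∑ c, ∑ d, g.comp e (e p) c d *
    covDerivVec (g.comp e) (fun a => coord e p a X) (fieldComp e Y) c (e p) * coord e p d Z

/-- `N` is co-geodetic: `g(∇_X Y, Z) = 0` for all (local) smooth sections `X`, `Y` of `N^⊥` and
`Z` of `N`. -/
def NullStructure.IsCoGeodetic (N : NullStructure g) : Prop :=
  ∀ U : Set M, IsOpen U → ∀ X Y Z : ∀ q : M, CTangent q,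
    SmoothFieldOn U X → SmoothFieldOn U Y → SmoothFieldOn U Z →
    (∀ q ∈ U, X q ∈ N.perp q) → (∀ q ∈ U, Y q ∈ N.perp q) → (∀ q ∈ U, Z q ∈ N.fiber q) →
    ∀ p ∈ U, ∀ e ∈ atlas E3 M, p ∈ e.source → metricCovDeriv g e p (X p) Y (Z p) = 0

/-- The Newman-Penrose coefficient `κ = n_b k^a ∇_a k^b` of a local frame `(k, l, n)`. -/
def kappa (g : ComplexMetric M) (e : OpenPartialHomeomorph M E3) (p : M)
    (k n : ∀ q : M, CTangent q) : ℂ :=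
  metricCovDeriv g e p (k p) k (n p)

/-- The Newman-Penrose coefficient `ρ = n_b n^a ∇_a k^b` of a local frame `(k, l, n)`. -/
def rho (g : ComplexMetric M) (e : OpenPartialHomeomorph M E3) (p : M)
    (k n : ∀ q : M, CTangent q) : ℂ :=
  metricCovDeriv g e p (n p) k (n p)

end Manifold

end

end GoldbergSachs

/-! Put φ = 2Φ₂. The vanishing of Φ₀ and Φ₁ says that a generator k of the null line is an
eigenvector of the tracefree Ricci tensor, Φ_{ab}k^b = φ k_a, and type II says φ ≠ 0
(`exists_tracefreeRicci_eigenvalue`). Differentiating this equation expresses ∇Φ contracted with k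
through ∂φ and ∇k alone (`covDeriv2_tracefreeRicci_mul`).

In the Cotton condition, k^a k^b ∇_cΦ_{ab} then drops out because k is null, k^a k^b ∇_bΦ_{ca}
contributes (k^b ∂_bφ) k_c, and the terms in S add up to 2 (k^a ∂_aS) k_c. The contracted Bianchi
identity ∇^aΦ_{ab} = 2∂_bS, contracted with k, gives 2 k^a ∂_aS = k^a ∂_aφ + E with E = φ ∇_ak^a -
Φ^{ab}∇_ak_b (`two_mul_pd_scalarS`). All derivatives of φ and S cancel; what remains is linear in
∇k: (Φ - φg)(∇_k k) + E k = 0, with index lowered.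

Tracefreeness forces Φ(n,n) = φ, whereas g(n,n) = -1/2. Hence the n-component reads -3φκ = 0, and
the l-component then reads E = -6φρ = 0. So κ = ρ = 0, and since k and n span the orthogonal
complement this is the claim (`dotProduct_covDeriv_eq_zero`).

The Bianchi identity is proved for connection matrices over a ring with commuting derivations, then
specialised to smooth functions on a coordinate domain. -/

namespace GoldbergSachs

/-! ### Curvature identities over a commutative ring with commuting derivations -/

section Algebraic

open Matrix

variable {A ι : Type*} [CommRing A]

theorem inverse_transpose [Fintype ι] [DecidableEq ι] {g h : Matrix ι ι A} (hs : gᵀ = g) (hgh : g * h = 1) : hᵀ = h := by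
  have h1 : hᵀ * g = 1 := by
    have := congrArg Matrix.transpose hgh
    rwa [Matrix.transpose_mul, hs, Matrix.transpose_one] at this
  calc hᵀ = hᵀ * (g * h) := by rw [hgh, mul_one]
    _ = h := by rw [← mul_assoc, h1, one_mul]

variable [Algebra ℂ A]

theorem eq_zero_of_eq_neg {x : A} (h : x = -x) : x = 0 := by
  have h2 : x + x = 0 := by linear_combination h
  have : x = (1 / 2 : ℂ) • (x + x) := by rw [← two_smul ℂ x, smul_smul]; norm_num
  rw [this, h2, smul_zero]

theorem map_derivation_add (D : Derivation ℂ A A) (M N : Matrix ι ι A) :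
    (M + N).map D = M.map D + N.map D := by
  ext i j; simp

theorem map_derivation_sub (D : Derivation ℂ A A) (M N : Matrix ι ι A) :
    (M - N).map D = M.map D - N.map D := by
  ext i j; simp

theorem map_derivation_comm {D D' : Derivation ℂ A A} (h : ∀ x, D (D' x) = D' (D x))
    (M : Matrix ι ι A) : (M.map D').map D = (M.map D).map D' := by
  ext i j; simp [h]

variable [Fintype ι]

theorem map_derivation_mul (D : Derivation ℂ A A) (M N : Matrix ι ι A) :
    (M * N).map D = M.map D * N + M * N.map D := by
  ext i j
  simp only [Matrix.map_apply, Matrix.mul_apply, Matrix.add_apply, map_sum, Derivation.leibniz,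
    smul_eq_mul, ← Finset.sum_add_distrib]
  exact Finset.sum_congr rfl fun _ _ => by ring

variable (d : ι → Derivation ℂ A A) (Γ : ι → Matrix ι ι A)

/-- The curvature `∂_a Γ_b - ∂_b Γ_a + [Γ_a, Γ_b]` of the connection matrices `Γ`; its `(c, f)` entry
is `R_{abf}{}^c`. -/
def curv (a b : ι) : Matrix ι ι A :=
  (Γ b).map (d a) - (Γ a).map (d b) + Γ a * Γ b - Γ b * Γ a

/-- The Ricci tensor `R_{ab} = R_{acb}{}^c`. -/
def ric : Matrix ι ι A := Matrix.of fun a b => ∑ c, curv d Γ a c c b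

theorem curv_swap (a b : ι) : curv d Γ a b = -curv d Γ b a := by
  unfold curv; abel

variable {d Γ}

/-- The differential Bianchi identity for dΓ + Γ∧Γ: only commuting derivations are needed. No
connection terms act on the form indices; for symmetric Γ those would cancel in the cyclic sum
anyway. -/
theorem curv_bianchi (hd : ∀ a b x, d a (d b x) = d b (d a x)) (a b c : ι) :
    ((curv d Γ a b).map (d c) + Γ c * curv d Γ a b - curv d Γ a b * Γ c) +
    ((curv d Γ b c).map (d a) + Γ a * curv d Γ b c - curv d Γ b c * Γ a) +
    ((curv d Γ c a).map (d b) + Γ b * curv d Γ c a - curv d Γ c a * Γ b) = 0 := by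
  unfold curv
  simp only [map_derivation_add, map_derivation_sub, map_derivation_mul]
  rw [map_derivation_comm (hd c a), map_derivation_comm (hd c b), map_derivation_comm (hd a b)]
  noncomm_ring

/-- The algebraic Bianchi identity: symmetry of Γ in its lower indices makes the terms cancel in
pairs, without commuting derivations. -/
theorem curv_cyclic (hΓ : ∀ a b c, Γ a c b = Γ b c a) (a b f c : ι) :
    curv d Γ a b c f + curv d Γ b f c a + curv d Γ f a c b = 0 := by
  simp only [curv, Matrix.add_apply, Matrix.sub_apply, Matrix.map_apply, Matrix.mul_apply]
  simp only [hΓ f b, hΓ a b, hΓ f a]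
  abel

variable {g h : Matrix ι ι A}

/-- The hypothesis `hg` is ∇g = 0. Applying two commuting derivations to g in either order gives its
integrability condition: curvature is skew for g. -/
theorem metric_mul_curv (hd : ∀ a b x, d a (d b x) = d b (d a x))
    (hg : ∀ a, g.map (d a) = (Γ a)ᵀ * g + g * Γ a) (a b : ι) :
    (curv d Γ a b)ᵀ * g = -(g * curv d Γ a b) := by
  have key := map_derivation_comm (hd a b) g
  rw [hg a, hg b] at key
  simp only [map_derivation_add, map_derivation_mul, hg, Matrix.transpose_map] at key
  have e : (curv d Γ a b)ᵀ = ((Γ b).map (d a))ᵀ - ((Γ a).map (d b))ᵀ + (Γ b)ᵀ * (Γ a)ᵀ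
      - (Γ a)ᵀ * (Γ b)ᵀ := by
    simp [curv]
  rw [e, ← sub_eq_zero, ← sub_eq_zero.mpr key]
  unfold curv
  noncomm_ring

variable [DecidableEq ι]

theorem map_inverse (hgh : g * h = 1)
    (hg : ∀ a, g.map (d a) = (Γ a)ᵀ * g + g * Γ a) (a : ι) :
    h.map (d a) = -(Γ a * h + h * (Γ a)ᵀ) := by
  have hhg : h * g = 1 := mul_eq_one_comm.mp hgh
  have h1 : (1 : Matrix ι ι A).map (d a) = 0 := by
    ext i j
    by_cases hij : i = j <;> simp [hij]
  have h2 := congrArg (fun M => h * Matrix.map M (d a)) hgh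
  simp only [map_derivation_mul, hg, h1, mul_zero] at h2
  have h3 : h * (((Γ a)ᵀ * g + g * Γ a) * h + g * h.map (d a)) =
      h * (Γ a)ᵀ * (g * h) + (h * g) * (Γ a * h) + (h * g) * h.map (d a) := by noncomm_ring
  rw [h3, hgh, hhg, mul_one, one_mul, one_mul] at h2
  rw [eq_neg_iff_add_eq_zero, ← h2]
  abel

theorem curv_mul_inverse_transpose (hd : ∀ a b x, d a (d b x) = d b (d a x))
    (hs : gᵀ = g) (hgh : g * h = 1)
    (hg : ∀ a, g.map (d a) = (Γ a)ᵀ * g + g * Γ a) (a b : ι) :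
    (curv d Γ a b * h)ᵀ = -(curv d Γ a b * h) := by
  have hhg : h * g = 1 := mul_eq_one_comm.mp hgh
  rw [Matrix.transpose_mul, inverse_transpose hs hgh]
  calc h * (curv d Γ a b)ᵀ = h * ((curv d Γ a b)ᵀ * g) * h := by
        rw [mul_assoc, mul_assoc, hgh, mul_one]
    _ = -((h * g) * (curv d Γ a b * h)) := by
        rw [metric_mul_curv hd hg]; noncomm_ring
    _ = _ := by rw [hhg, one_mul]

/-- The trace pairs a skew matrix, the curvature with an index raised, with the symmetric matrix g.
-/
theorem trace_curv (hd : ∀ a b x, d a (d b x) = d b (d a x))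
    (hs : gᵀ = g) (hgh : g * h = 1)
    (hg : ∀ a, g.map (d a) = (Γ a)ᵀ * g + g * Γ a) (a b : ι) :
    Matrix.trace (curv d Γ a b) = 0 := by
  have hhg : h * g = 1 := mul_eq_one_comm.mp hgh
  apply eq_zero_of_eq_neg
  calc Matrix.trace (curv d Γ a b) = Matrix.trace ((curv d Γ a b * h) * g) := by
        rw [mul_assoc, hhg, mul_one]
    _ = Matrix.trace (((curv d Γ a b * h) * g)ᵀ) := (Matrix.trace_transpose _).symm
    _ = Matrix.trace (g * -(curv d Γ a b * h)) := by
        rw [Matrix.transpose_mul, curv_mul_inverse_transpose hd hs hgh hg, hs]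
    _ = -Matrix.trace ((curv d Γ a b * h) * g) := by
        rw [Matrix.trace_mul_comm, neg_mul, Matrix.trace_neg]
    _ = _ := by rw [mul_assoc, hhg, mul_one]

/-- By the cyclic identity, the antisymmetric part of Ricci is a trace of the curvature, which
vanishes. -/
theorem ric_transpose (hd : ∀ a b x, d a (d b x) = d b (d a x))
    (hΓ : ∀ a b c, Γ a c b = Γ b c a) (hs : gᵀ = g) (hgh : g * h = 1)
    (hg : ∀ a, g.map (d a) = (Γ a)ᵀ * g + g * Γ a) : (ric d Γ)ᵀ = ric d Γ := by
  ext a b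
  simp only [ric, Matrix.transpose_apply, Matrix.of_apply]
  have h0 := trace_curv hd hs hgh hg a b
  simp only [Matrix.trace, Matrix.diag_apply] at h0
  rw [eq_comm, ← sub_eq_zero, ← h0, ← Finset.sum_sub_distrib]
  refine Finset.sum_congr rfl fun c _ => ?_
  have h1 := curv_cyclic (d := d) hΓ a b c c
  have h2 : curv d Γ c a c b = -curv d Γ a c c b := by rw [curv_swap]; rfl
  linear_combination h2 - h1

/-- The double trace of the differential Bianchi identity, taken after raising an index so that both
pair antisymmetries become plain sign changes and traces need no metric. -/
theorem contracted_bianchi (hd : ∀ a b x, d a (d b x) = d b (d a x))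
    (hΓ : ∀ a b c, Γ a c b = Γ b c a) (hs : gᵀ = g) (hgh : g * h = 1)
    (hg : ∀ a, g.map (d a) = (Γ a)ᵀ * g + g * Γ a) (e : ι) :
    2 * ∑ a, (((ric d Γ).map (d a) - (Γ a)ᵀ * ric d Γ - ric d Γ * Γ a) * h) e a =
      d e (∑ a, ∑ b, h a b * ric d Γ a b) := by
  have hhg : h * g = 1 := mul_eq_one_comm.mp hgh
  set W : ι → ι → Matrix ι ι A := fun a b => curv d Γ a b * h with hW
  have W_swap : ∀ a b i j, W a b i j = -W b a i j := fun a b i j => by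
    simp only [hW]; rw [curv_swap]; simp
  have W_symm : ∀ a b i j, W a b i j = -W a b j i := fun a b i j =>
    congrFun (congrFun (curv_mul_inverse_transpose hd hs hgh hg a b) j) i
  set ρ : Matrix ι ι A := ric d Γ * h with hρ
  have ρ_eq : ∀ i j, ρ i j = ∑ b, W b i j b := by
    intro i j
    simp only [hρ, ric, Matrix.mul_apply, Matrix.of_apply, Finset.sum_mul]
    rw [Finset.sum_comm]
    refine Finset.sum_congr rfl fun b _ => ?_
    rw [W_swap, W_symm, neg_neg]
    simp [hW, Matrix.mul_apply]
  -- the divergence of the mixed Ricci tensor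
  have div_eq : ∀ a, ((ric d Γ).map (d a) - (Γ a)ᵀ * ric d Γ - ric d Γ * Γ a) * h =
      ρ.map (d a) - (Γ a)ᵀ * ρ + ρ * (Γ a)ᵀ := by
    intro a
    rw [hρ, map_derivation_mul, map_inverse hgh hg a]
    noncomm_ring
  have scal_eq : ∑ a, ∑ b, h a b * ric d Γ a b = ∑ a, ρ a a := by
    refine Finset.sum_congr rfl fun a _ => ?_
    rw [hρ, Matrix.mul_apply]
    refine Finset.sum_congr rfl fun b _ => ?_
    rw [show h a b = h b a from congrFun (congrFun (inverse_transpose hs hgh) b) a, mul_comm]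
  -- the second Bianchi identity with the last index raised
  set U : ι → ι → ι → Matrix ι ι A := fun c a b =>
    (W a b).map (d c) + Γ c * W a b + W a b * (Γ c)ᵀ with hU
  have U_eq : ∀ c a b, U c a b =
      ((curv d Γ a b).map (d c) + Γ c * curv d Γ a b - curv d Γ a b * Γ c) * h := by
    intro c a b
    simp only [hU, hW, map_derivation_mul, map_inverse hgh hg c]
    noncomm_ring
  have U_cyc : ∀ c a b, U c a b + U a b c + U b c a = 0 := by
    intro c a b
    rw [U_eq, U_eq, U_eq, ← add_mul, ← add_mul, curv_bianchi hd, zero_mul]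
  have U_apply : ∀ c a b i j, U c a b i j =
      d c (W a b i j) + ∑ f, Γ c i f * W a b f j + ∑ f, W a b i f * Γ c j f := by
    intro c a b i j
    simp only [hU, Matrix.add_apply, Matrix.map_apply, Matrix.mul_apply, Matrix.transpose_apply]
  have U_flip : ∀ c a b i j, U c a b i j = U c b a j i := by
    intro c a b i j
    have hflip : ∀ i j, W a b i j = W b a j i := fun i j => by rw [W_swap, W_symm, neg_neg]
    simp only [U_apply, hflip]
    rw [add_assoc, add_assoc]
    congr 1
    rw [add_comm]
    congr 1 <;> exact Finset.sum_congr rfl fun _ _ => mul_comm _ _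
  -- Of the three cyclic terms, the last two have equal double traces by the two antisymmetries;
  -- this is the origin of the factor 2.
  have U_sum : ∑ a, ∑ b, U e a b a b = -(2 * ∑ a, ∑ b, U a b e a b) := by
    have h1 : ∑ a, ∑ b, (U e a b a b + U a b e a b + U b e a a b) = 0 :=
      Finset.sum_eq_zero fun a _ => Finset.sum_eq_zero fun b _ =>
        congrFun (congrFun (U_cyc e a b) a) b
    simp only [Finset.sum_add_distrib] at h1
    have h2 : ∑ a, ∑ b, U b e a a b = ∑ a, ∑ b, U a b e a b := by
      rw [Finset.sum_comm]
      exact Finset.sum_congr rfl fun a _ => Finset.sum_congr rfl fun b _ => U_flip _ _ _ _ _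
    rw [h2] at h1
    linear_combination h1
  have U_left : ∑ a, ∑ b, U e a b a b = -(d e (∑ a, ρ a a)) - 2 * ∑ a, ∑ f, Γ e a f * ρ a f := by
    have n1 : ∀ i j, ∑ b, W i b j b = -ρ i j := fun i j => by
      rw [ρ_eq, ← Finset.sum_neg_distrib]
      exact Finset.sum_congr rfl fun b _ => W_swap _ _ _ _
    have n2 : ∀ i j, ∑ a, W a i a j = -ρ i j := fun i j => by
      rw [ρ_eq, ← Finset.sum_neg_distrib]
      exact Finset.sum_congr rfl fun b _ => W_symm _ _ _ _
    simp only [U_apply, Finset.sum_add_distrib]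
    have t1 : ∑ a, ∑ b, d e (W a b a b) = -(d e (∑ a, ρ a a)) := by
      simp only [← map_sum, n1, Finset.sum_neg_distrib, map_neg]
    have t2 : ∑ a, ∑ b, ∑ f, Γ e a f * W a b f b = -∑ a, ∑ f, Γ e a f * ρ a f := by
      simp only [← Finset.sum_neg_distrib]
      refine Finset.sum_congr rfl fun a _ => ?_
      rw [Finset.sum_comm]
      refine Finset.sum_congr rfl fun f _ => ?_
      rw [← Finset.mul_sum, n1, mul_neg]
    have t3 : ∑ a, ∑ b, ∑ f, W a b a f * Γ e b f = -∑ a, ∑ f, Γ e a f * ρ a f := by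
      simp only [← Finset.sum_neg_distrib]
      rw [Finset.sum_comm]
      refine Finset.sum_congr rfl fun b _ => ?_
      rw [Finset.sum_comm]
      refine Finset.sum_congr rfl fun f _ => ?_
      rw [← Finset.sum_mul, n2, neg_mul, mul_comm]
    rw [t1, t2, t3]
    ring
  have U_right : ∑ a, ∑ b, U a b e a b =
      ∑ a, (d a (ρ e a) + ∑ f, ρ e f * Γ a a f) := by
    simp only [U_apply, Finset.sum_add_distrib]
    -- Skew in the raised pair against symmetric in the lower indices of Γ.
    have t3 : ∑ a, ∑ b, ∑ f, W b e a f * Γ a b f = 0 := by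
      apply eq_zero_of_eq_neg
      rw [Finset.sum_comm, ← Finset.sum_neg_distrib]
      refine Finset.sum_congr rfl fun b _ => ?_
      rw [← Finset.sum_neg_distrib]
      conv_lhs => rw [Finset.sum_comm]
      refine Finset.sum_congr rfl fun a _ => ?_
      rw [← Finset.sum_neg_distrib]
      refine Finset.sum_congr rfl fun f _ => ?_
      rw [W_symm, hΓ, neg_mul]
    rw [t3, add_zero]
    congr 1
    · simp only [← map_sum, ρ_eq]
    · refine Finset.sum_congr rfl fun a _ => ?_
      rw [Finset.sum_comm]
      refine Finset.sum_congr rfl fun f _ => ?_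
      rw [← Finset.mul_sum, ← ρ_eq, mul_comm]
  have div_sum : ∑ a, (ρ.map (d a) - (Γ a)ᵀ * ρ + ρ * (Γ a)ᵀ) e a =
      ∑ a, (d a (ρ e a) + ∑ f, ρ e f * Γ a a f) - ∑ a, ∑ f, Γ e a f * ρ a f := by
    have : ∑ a, ∑ f, Γ e a f * ρ a f = ∑ a, ∑ f, Γ a f e * ρ f a := by
      rw [Finset.sum_comm]
      exact Finset.sum_congr rfl fun a _ => Finset.sum_congr rfl fun f _ => by rw [hΓ]
    rw [this, ← Finset.sum_sub_distrib]
    refine Finset.sum_congr rfl fun a _ => ?_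
    simp only [Matrix.add_apply, Matrix.sub_apply, Matrix.map_apply, Matrix.mul_apply,
      Matrix.transpose_apply]
    ring
  simp only [div_eq]
  rw [scal_eq, div_sum, ← U_right]
  linear_combination U_sum - U_left

end Algebraic

/-! ### Smooth functions on a coordinate domain -/

section SmoothFunctions

open Filter Topology

variable {V : Set E3}

theorem differentiableAt_of_contDiffOn (hV : IsOpen V) {f : E3 → ℂ} (hf : ContDiffOn ℝ ∞ f V)
    {y : E3} (hy : y ∈ V) : DifferentiableAt ℝ f y :=
  (hf.contDiffAt (hV.mem_nhds hy)).differentiableAt (by simp)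

theorem pd_congr (a : Fin 3) {f F : E3 → ℂ} {y : E3} (h : f =ᶠ[𝓝 y] F) : pd a f y = pd a F y := by
  unfold pd; rw [h.fderiv_eq]

theorem pd_congr_on (hV : IsOpen V) (a : Fin 3) {f F : E3 → ℂ} (h : ∀ x ∈ V, f x = F x) {y : E3}
    (hy : y ∈ V) : pd a f y = pd a F y :=
  pd_congr a (eventually_of_mem (hV.mem_nhds hy) h)

theorem pd_add (a : Fin 3) {f F : E3 → ℂ} {y : E3} (hf : DifferentiableAt ℝ f y)
    (hF : DifferentiableAt ℝ F y) : pd a (fun x => f x + F x) y = pd a f y + pd a F y := by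
  unfold pd; rw [fderiv_fun_add hf hF]; rfl

theorem pd_sub (a : Fin 3) {f F : E3 → ℂ} {y : E3} (hf : DifferentiableAt ℝ f y)
    (hF : DifferentiableAt ℝ F y) : pd a (fun x => f x - F x) y = pd a f y - pd a F y := by
  unfold pd; rw [fderiv_fun_sub hf hF]; rfl

theorem pd_mul (a : Fin 3) {f F : E3 → ℂ} {y : E3} (hf : DifferentiableAt ℝ f y)
    (hF : DifferentiableAt ℝ F y) :
    pd a (fun x => f x * F x) y = f y * pd a F y + F y * pd a f y := by
  unfold pd; rw [fderiv_fun_mul hf hF]; rfl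

theorem pd_const_mul (a : Fin 3) (c : ℂ) {f : E3 → ℂ} {y : E3} (hf : DifferentiableAt ℝ f y) :
    pd a (fun x => c * f x) y = c * pd a f y := by
  unfold pd; rw [fderiv_const_mul hf]; rfl

theorem pd_neg (a : Fin 3) {f : E3 → ℂ} {y : E3} : pd a (fun x => -f x) y = -pd a f y := by
  unfold pd; rw [fderiv_fun_neg]; rfl

theorem pd_sum (a : Fin 3) {F : Fin 3 → E3 → ℂ} {y : E3} (hF : ∀ i, DifferentiableAt ℝ (F i) y) :
    pd a (fun x => ∑ i, F i x) y = ∑ i, pd a (F i) y := by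
  unfold pd; rw [fderiv_fun_sum fun i _ => hF i]; simp

theorem contDiffOn_pd (hV : IsOpen V) (a : Fin 3) {f : E3 → ℂ} (hf : ContDiffOn ℝ ∞ f V) :
    ContDiffOn ℝ ∞ (pd a f) V :=
  (hf.fderiv_of_isOpen hV (m := ∞) (by simp)).clm_apply contDiffOn_const

theorem pd_pd_comm (hV : IsOpen V) (a b : Fin 3) {f : E3 → ℂ} (hf : ContDiffOn ℝ ∞ f V)
    {y : E3} (hy : y ∈ V) : pd a (pd b f) y = pd b (pd a f) y := by
  have hd : DifferentiableAt ℝ (fderiv ℝ f) y :=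
    ((hf.fderiv_of_isOpen hV (m := ∞) (by simp)).contDiffAt (hV.mem_nhds hy)).differentiableAt
      (by simp)
  have key : ∀ i j, pd i (pd j f) y = fderiv ℝ (fderiv ℝ f) y (EuclideanSpace.single i 1)
      (EuclideanSpace.single j 1) := by
    intro i j
    show fderiv ℝ (fun x => fderiv ℝ f x (EuclideanSpace.single j 1)) y _ = _
    rw [fderiv_clm_apply hd (differentiableAt_const _)]
    simp
  rw [key, key]
  have hs : IsSymmSndFDerivAt ℝ f y :=
    (hf.contDiffAt (hV.mem_nhds hy)).isSymmSndFDerivAt (by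
      -- Over ℝ, symmetry of the second derivative requires only C².
      rw [minSmoothness_of_isRCLikeNormedField]; exact WithTop.coe_le_coe.mpr le_top)
  exact hs _ _

/-- The algebra of smooth complex-valued functions on `V`. -/
def smoothAlg (V : Set E3) : Subalgebra ℂ (V → ℂ) where
  carrier := {f | ∃ F : E3 → ℂ, ContDiffOn ℝ ∞ F V ∧ ∀ x : V, f x = F x}
  mul_mem' := by
    rintro f f' ⟨F, hF, h⟩ ⟨F', hF', h'⟩
    exact ⟨fun x => F x * F' x, hF.mul hF', fun x => by simp [h, h']⟩
  add_mem' := by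
    rintro f f' ⟨F, hF, h⟩ ⟨F', hF', h'⟩
    exact ⟨fun x => F x + F' x, hF.add hF', fun x => by simp [h, h']⟩
  algebraMap_mem' := fun c => ⟨fun _ => c, contDiffOn_const, fun _ => rfl⟩

/-- The extension by zero of a smooth function on `V`. -/
noncomputable def extendZero (f : smoothAlg V) : E3 → ℂ := Function.extend Subtype.val f.1 0

theorem extendZero_apply (f : smoothAlg V) {y : E3} (hy : y ∈ V) :
    extendZero f y = f.1 ⟨y, hy⟩ :=
  Subtype.val_injective.extend_apply f.1 0 ⟨y, hy⟩

theorem contDiffOn_extendZero (f : smoothAlg V) : ContDiffOn ℝ ∞ (extendZero f) V := by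
  obtain ⟨F, hF, h⟩ := f.2
  exact hF.congr fun x hx => by rw [extendZero_apply f hx, h]

/-- Restriction to `V` of a function that is smooth there. -/
def toSmooth (F : E3 → ℂ) (hF : ContDiffOn ℝ ∞ F V) : smoothAlg V :=
  ⟨fun x => F x, F, hF, fun _ => rfl⟩

/-- The partial derivative as a derivation of the algebra of smooth functions. -/
noncomputable def pdDer (hV : IsOpen V) (a : Fin 3) : Derivation ℂ (smoothAlg V) (smoothAlg V) :=
  Derivation.mk'
    -- The values chosen outside V are immaterial: V is open, so derivatives at its points depend
    -- only on the restriction to V.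
    { toFun := fun f => toSmooth (pd a (extendZero f)) (contDiffOn_pd hV a (contDiffOn_extendZero f))
      map_add' := by
        intro f f'
        ext ⟨y, hy⟩
        have hf := differentiableAt_of_contDiffOn hV (contDiffOn_extendZero f) hy
        have hf' := differentiableAt_of_contDiffOn hV (contDiffOn_extendZero f') hy
        show pd a _ y = pd a _ y + pd a _ y
        rw [← pd_add a hf hf']
        refine pd_congr_on hV a (fun x hx => ?_) hy
        simp [extendZero_apply _ hx]
      map_smul' := by
        intro c f
        ext ⟨y, hy⟩
        have hf := differentiableAt_of_contDiffOn hV (contDiffOn_extendZero f) hy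
        show pd a _ y = c * pd a _ y
        rw [← pd_const_mul a c hf]
        refine pd_congr_on hV a (fun x hx => ?_) hy
        simp [extendZero_apply _ hx] }
    (by
      intro f f'
      ext ⟨y, hy⟩
      have hf := differentiableAt_of_contDiffOn hV (contDiffOn_extendZero f) hy
      have hf' := differentiableAt_of_contDiffOn hV (contDiffOn_extendZero f') hy
      show pd a _ y = f.1 ⟨y, hy⟩ * pd a _ y + f'.1 ⟨y, hy⟩ * pd a _ y
      rw [← extendZero_apply f hy, ← extendZero_apply f' hy, ← pd_mul a hf hf']
      refine pd_congr_on hV a (fun x hx => ?_) hy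
      simp [extendZero_apply _ hx])

/-- Evaluation of smooth functions at a point. -/
def evalAt {y : E3} (hy : y ∈ V) : smoothAlg V →+* ℂ :=
  (Pi.evalRingHom (fun _ : V => ℂ) ⟨y, hy⟩).comp (smoothAlg V).val.toRingHom

theorem evalAt_toSmooth {F : E3 → ℂ} (hF : ContDiffOn ℝ ∞ F V) {y : E3} (hy : y ∈ V) :
    evalAt hy (toSmooth F hF) = F y := rfl

theorem smoothAlg_ext {f f' : smoothAlg V}
    (h : ∀ (y : E3) (hy : y ∈ V), evalAt hy f = evalAt hy f') : f = f' := by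
  ext ⟨y, hy⟩; exact h y hy

/-- Any function that agrees with the algebra element on V may be differentiated, so abstract
identities turn into identities between coordinate expressions. -/
theorem evalAt_pdDer (hV : IsOpen V) (a : Fin 3) {f : smoothAlg V} {F : E3 → ℂ}
    (h : ∀ (x : E3) (hx : x ∈ V), evalAt hx f = F x) {y : E3} (hy : y ∈ V) :
    evalAt hy (pdDer hV a f) = pd a F y :=
  pd_congr_on hV a (fun x hx => by rw [extendZero_apply f hx]; exact h x hx) hy

theorem pdDer_comm (hV : IsOpen V) (a b : Fin 3) (f : smoothAlg V) :
    pdDer hV a (pdDer hV b f) = pdDer hV b (pdDer hV a f) := by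
  refine smoothAlg_ext fun y hy => ?_
  have h : ∀ c (x : E3) (hx : x ∈ V), evalAt hx (pdDer hV c f) = pd c (extendZero f) x :=
    fun c x hx => evalAt_pdDer hV c (fun z hz => (extendZero_apply f hz).symm) hx
  rw [evalAt_pdDer hV a (h b) hy, evalAt_pdDer hV b (h a) hy]
  exact pd_pd_comm hV a b (contDiffOn_extendZero f) hy

end SmoothFunctions

/-! ### The Ricci tensor in a coordinate domain -/

section CoordinateRicci

open Matrix

/-- `G` is the component matrix of a smooth nondegenerate metric on the open set `V`. -/
structure IsMetricOn (G : E3 → Matrix (Fin 3) (Fin 3) ℂ) (V : Set E3) : Prop where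
  isOpen : IsOpen V
  smooth : ∀ i j, ContDiffOn ℝ ∞ (fun y => G y i j) V
  symm : ∀ y i j, G y i j = G y j i
  det_ne_zero : ∀ y ∈ V, (G y).det ≠ 0

variable {G : E3 → Matrix (Fin 3) (Fin 3) ℂ} {V : Set E3}

theorem contDiffOn_det {M : E3 → Matrix (Fin 3) (Fin 3) ℂ}
    (hM : ∀ i j, ContDiffOn ℝ ∞ (fun y => M y i j) V) : ContDiffOn ℝ ∞ (fun y => (M y).det) V := by
  simp only [Matrix.det_fin_three]
  have := hM
  fun_prop

namespace IsMetricOn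

theorem mono {W : Set E3} (h : IsMetricOn G V) (hW : IsOpen W) (hWV : W ⊆ V) : IsMetricOn G W :=
  ⟨hW, fun i j => (h.smooth i j).mono hWV, h.symm, fun y hy => h.det_ne_zero y (hWV hy)⟩

variable (h : IsMetricOn G V)
include h

theorem mul_inv {y : E3} (hy : y ∈ V) : G y * (G y)⁻¹ = 1 :=
  Matrix.mul_nonsing_inv _ (isUnit_iff_ne_zero.mpr (h.det_ne_zero y hy))

theorem transpose_eq (y : E3) : (G y)ᵀ = G y := by
  ext i j; exact h.symm y j i

theorem inv_symm {y : E3} (hy : y ∈ V) (i j : Fin 3) : (G y)⁻¹ i j = (G y)⁻¹ j i :=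
  congrFun (congrFun (inverse_transpose (h.transpose_eq y) (h.mul_inv hy)) j) i

/-- Cramer's rule: the adjugate is polynomial in the entries and the determinant does not vanish. -/
theorem smooth_inv (i j : Fin 3) : ContDiffOn ℝ ∞ (fun y => (G y)⁻¹ i j) V := by
  have hadj : ContDiffOn ℝ ∞ (fun y => (G y).adjugate i j) V := by
    simp only [Matrix.adjugate_apply]
    refine contDiffOn_det fun r s => ?_
    by_cases hr : r = j
    · subst hr; simpa using contDiffOn_const
    · simpa [Matrix.updateRow_apply, hr] using h.smooth r s
  refine (((contDiffOn_det h.smooth).inv h.det_ne_zero).mul hadj).congr fun y hy => ?_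
  rw [Matrix.inv_def, Ring.inverse_eq_inv', Matrix.smul_apply, smul_eq_mul]; rfl

theorem smooth_christoffel (c a b : Fin 3) : ContDiffOn ℝ ∞ (christoffel G c a b) V := by
  unfold christoffel
  refine contDiffOn_const.mul (ContDiffOn.sum fun d _ => (h.smooth_inv c d).mul ?_)
  exact ((contDiffOn_pd h.isOpen a (h.smooth d b)).add
    (contDiffOn_pd h.isOpen b (h.smooth d a))).sub (contDiffOn_pd h.isOpen d (h.smooth a b))

theorem smooth_riemann (a b d c : Fin 3) : ContDiffOn ℝ ∞ (riemann G a b d c) V := by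
  unfold riemann
  have hΓ := h.smooth_christoffel
  refine ((contDiffOn_pd h.isOpen a (hΓ c b d)).sub (contDiffOn_pd h.isOpen b (hΓ c a d))).add
    (ContDiffOn.sum fun f _ => ((hΓ c a f).mul (hΓ f b d)).sub ((hΓ c b f).mul (hΓ f a d)))

theorem smooth_ricci (a b : Fin 3) : ContDiffOn ℝ ∞ (ricci G a b) V :=
  ContDiffOn.sum fun c _ => h.smooth_riemann a c b c

theorem smooth_scalar : ContDiffOn ℝ ∞ (scalar G) V :=
  ContDiffOn.sum fun a _ => ContDiffOn.sum fun b _ => (h.smooth_inv a b).mul (h.smooth_ricci a b)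

theorem smooth_tracefreeRicci (a b : Fin 3) : ContDiffOn ℝ ∞ (tracefreeRicci G a b) V :=
  (h.smooth_ricci a b).sub ((contDiffOn_const.mul h.smooth_scalar).mul (h.smooth a b))

theorem christoffel_symm (c a b : Fin 3) (y : E3) :
    christoffel G c a b y = christoffel G c b a y := by
  unfold christoffel
  have : (fun x => G x a b) = fun x => G x b a := funext fun x => h.symm x a b
  rw [this]
  congr 1
  exact Finset.sum_congr rfl fun d _ => by ring

theorem metric_mul_christoffel {y : E3} (hy : y ∈ V) (i a j : Fin 3) :
    ∑ c, G y i c * christoffel G c a j y = (1 / 2) * (pd a (fun x => G x i j) y +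
      pd j (fun x => G x i a) y - pd i (fun x => G x a j) y) := by
  set t : Fin 3 → ℂ := fun d =>
    pd a (fun x => G x d j) y + pd j (fun x => G x d a) y - pd d (fun x => G x a j) y with ht
  have e : (fun c => christoffel G c a j y) = (1 / 2 : ℂ) • ((G y)⁻¹ *ᵥ t) := by
    ext c; simp [christoffel, Matrix.mulVec, dotProduct, ht]
  have e2 : ∑ c, G y i c * christoffel G c a j y =
      (G y *ᵥ fun c => christoffel G c a j y) i := rfl
  rw [e2, e, Matrix.mulVec_smul, Matrix.mulVec_mulVec, h.mul_inv hy, Matrix.one_mulVec]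
  rfl

/-- Metric compatibility: when the two lowered Christoffel symbols are added, every derivative
except the one along a cancels. -/
theorem pd_metric {y : E3} (hy : y ∈ V) (a i j : Fin 3) :
    pd a (fun x => G x i j) y = ∑ c, christoffel G c a i y * G y c j +
      ∑ c, G y i c * christoffel G c a j y := by
  have e : ∑ c, christoffel G c a i y * G y c j = ∑ c, G y j c * christoffel G c a i y :=
    Finset.sum_congr rfl fun c _ => by rw [h.symm y c j, mul_comm]
  have hs : ∀ r s, (fun x => G x r s) = fun x => G x s r := fun r s => funext fun x => h.symm x r s
  rw [e, h.metric_mul_christoffel hy, h.metric_mul_christoffel hy, hs j i, hs j a, hs a i]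
  ring

/-- The Christoffel matrices with entries in the algebra of smooth functions on `V`. -/
noncomputable def gammaAlg (a : Fin 3) : Matrix (Fin 3) (Fin 3) (smoothAlg V) :=
  Matrix.of fun c b => toSmooth (christoffel G c a b) (h.smooth_christoffel c a b)

/-- The metric with entries in the algebra of smooth functions on `V`. -/
noncomputable def metricAlg : Matrix (Fin 3) (Fin 3) (smoothAlg V) :=
  Matrix.of fun a b => toSmooth (fun y => G y a b) (h.smooth a b)

/-- The inverse metric with entries in the algebra of smooth functions on `V`. -/
noncomputable def inverseAlg : Matrix (Fin 3) (Fin 3) (smoothAlg V) :=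
  Matrix.of fun a b => toSmooth (fun y => (G y)⁻¹ a b) (h.smooth_inv a b)

theorem gammaAlg_symm (a b c : Fin 3) : h.gammaAlg a c b = h.gammaAlg b c a :=
  smoothAlg_ext fun y _ => h.christoffel_symm c a b y

theorem metricAlg_transpose : h.metricAlgᵀ = h.metricAlg := by
  refine Matrix.ext fun i j => ?_
  exact smoothAlg_ext fun y _ => h.symm y j i

theorem metricAlg_mul_inverseAlg : h.metricAlg * h.inverseAlg = 1 := by
  refine Matrix.ext fun i j => ?_
  refine smoothAlg_ext fun y hy => ?_
  rw [Matrix.mul_apply, map_sum]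
  have e := congrFun (congrFun (h.mul_inv hy) i) j
  rw [Matrix.mul_apply] at e
  simp only [map_mul, metricAlg, inverseAlg, Matrix.of_apply, evalAt_toSmooth, e]
  by_cases hij : i = j <;> simp [Matrix.one_apply, hij]

theorem map_metricAlg (a : Fin 3) : h.metricAlg.map (pdDer h.isOpen a) =
    (h.gammaAlg a)ᵀ * h.metricAlg + h.metricAlg * h.gammaAlg a := by
  refine Matrix.ext fun i j => ?_
  refine smoothAlg_ext fun y hy => ?_
  rw [Matrix.map_apply, evalAt_pdDer h.isOpen a (F := fun x => G x i j) (fun _ _ => rfl) hy,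
    h.pd_metric hy]
  simp only [Matrix.add_apply, Matrix.mul_apply, Matrix.transpose_apply, map_add, map_sum, map_mul,
    metricAlg, gammaAlg, Matrix.of_apply, evalAt_toSmooth]

theorem evalAt_curv {y : E3} (hy : y ∈ V) (a b c f : Fin 3) :
    evalAt hy (curv (pdDer h.isOpen) h.gammaAlg a b c f) = riemann G a b f c y := by
  have hd : ∀ i r s t, evalAt hy (pdDer h.isOpen i (h.gammaAlg r s t)) =
      pd i (christoffel G s r t) y :=
    fun i r s t => evalAt_pdDer h.isOpen i (fun _ _ => rfl) hy
  simp only [curv, Matrix.add_apply, Matrix.sub_apply, Matrix.map_apply, Matrix.mul_apply,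
    map_add, map_sub, map_sum, map_mul, hd, riemann, Finset.sum_sub_distrib]
  simp only [gammaAlg, Matrix.of_apply, evalAt_toSmooth]
  ring

theorem evalAt_ric {y : E3} (hy : y ∈ V) (a b : Fin 3) :
    evalAt hy (ric (pdDer h.isOpen) h.gammaAlg a b) = ricci G a b y := by
  simp only [ric, Matrix.of_apply, map_sum, h.evalAt_curv, ricci]

theorem ricci_symm {y : E3} (hy : y ∈ V) (a b : Fin 3) : ricci G a b y = ricci G b a y := by
  rw [← h.evalAt_ric hy, ← h.evalAt_ric hy]
  exact congrArg _ (congrFun (congrFun (ric_transpose (pdDer_comm h.isOpen) h.gammaAlg_symm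
    h.metricAlg_transpose h.metricAlg_mul_inverseAlg h.map_metricAlg) b) a)

theorem divergence_ricci {y : E3} (hy : y ∈ V) (e : Fin 3) :
    2 * ∑ a, ∑ f, covDeriv2 G (ricci G) a e f y * (G y)⁻¹ f a = pd e (scalar G) y := by
  have key := congrArg (evalAt hy) (contracted_bianchi (pdDer_comm h.isOpen) h.gammaAlg_symm
    h.metricAlg_transpose h.metricAlg_mul_inverseAlg h.map_metricAlg e)
  rw [evalAt_pdDer h.isOpen e (F := scalar G)] at key
  · rw [← key, map_mul, map_sum, map_ofNat]
    congr 1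
    refine Finset.sum_congr rfl fun a _ => ?_
    rw [Matrix.mul_apply, map_sum]
    refine Finset.sum_congr rfl fun f _ => ?_
    have hd : ∀ i r s, evalAt hy (pdDer h.isOpen i (ric (pdDer h.isOpen) h.gammaAlg r s)) =
        pd i (ricci G r s) y :=
      fun i r s => evalAt_pdDer h.isOpen i (fun _ hx => h.evalAt_ric hx r s) hy
    simp only [Matrix.sub_apply, Matrix.map_apply, Matrix.mul_apply, Matrix.transpose_apply,
      map_mul, map_sub, map_sum, hd, h.evalAt_ric, covDeriv2]
    simp only [gammaAlg, inverseAlg, Matrix.of_apply, evalAt_toSmooth, mul_comm]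
  · intro x hx
    simp only [map_sum, map_mul, h.evalAt_ric, scalar]
    rfl

end IsMetricOn

end CoordinateRicci

/-! ### Pointwise linear algebra -/

section Pointwise

open Matrix

variable {g Φ : Matrix (Fin 3) (Fin 3) ℂ}

theorem dotProduct_mulVec_comm (hg : gᵀ = g) (v w : Fin 3 → ℂ) : v ⬝ᵥ g *ᵥ w = w ⬝ᵥ g *ᵥ v := by
  rw [dotProduct_mulVec, ← mulVec_transpose, hg, dotProduct_comm]

/-- Expansion of the inverse metric in an adapted frame. -/
theorem inverse_eq_of_frame {k l n : Fin 3 → ℂ} (hg : gᵀ = g)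
    (hkk : k ⬝ᵥ g *ᵥ k = 0) (hll : l ⬝ᵥ g *ᵥ l = 0) (hkn : k ⬝ᵥ g *ᵥ n = 0)
    (hln : l ⬝ᵥ g *ᵥ n = 0) (hkl : k ⬝ᵥ g *ᵥ l = 1) (hnn : n ⬝ᵥ g *ᵥ n = -(1 / 2)) (a b : Fin 3) :
    g⁻¹ a b = k a * l b + l a * k b - 2 * (n a * n b) := by
  set P : Matrix (Fin 3) (Fin 3) ℂ := Matrix.of ![k, l, n] with hP
  set Q : Matrix (Fin 3) (Fin 3) ℂ := Matrix.of ![l, k, (-2 : ℂ) • n] with hQ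
  have hlk : l ⬝ᵥ g *ᵥ k = 1 := by rw [dotProduct_mulVec_comm hg, hkl]
  have hnk : n ⬝ᵥ g *ᵥ k = 0 := by rw [dotProduct_mulVec_comm hg, hkn]
  have hnl : n ⬝ᵥ g *ᵥ l = 0 := by rw [dotProduct_mulVec_comm hg, hln]
  have h1 : P * (g * Qᵀ) = 1 := by
    ext i j
    have : (P * (g * Qᵀ)) i j = ![k, l, n] i ⬝ᵥ g *ᵥ ![l, k, (-2 : ℂ) • n] j := by
      rw [Matrix.mul_apply']
      congr 1
    rw [this]
    fin_cases i <;> fin_cases j <;>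
      simp [mulVec_neg, mulVec_smul, hkk, hll, hkn, hln, hkl, hnn, hlk, hnk, hnl]
  have h2 : g * (Qᵀ * P) = 1 := by
    rw [← mul_assoc]; exact mul_eq_one_comm.mp h1
  rw [Matrix.inv_eq_right_inv h2, Matrix.mul_apply, Fin.sum_univ_three]
  simp [hP, hQ]
  ring

/-- The algebraic heart of the theorem: `F a` is the vector `∇_a k`, and `hE` is the Cotton tensor
condition after the derivatives of the curvature have been eliminated. -/
theorem dotProduct_covDeriv_eq_zero {k l n : Fin 3 → ℂ} {F : Fin 3 → Fin 3 → ℂ} {φ : ℂ}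
    (hg : gᵀ = g) (hgdet : g.det ≠ 0) (hΦ : Φᵀ = Φ)
    (hkk : k ⬝ᵥ g *ᵥ k = 0) (hll : l ⬝ᵥ g *ᵥ l = 0) (hkn : k ⬝ᵥ g *ᵥ n = 0)
    (hln : l ⬝ᵥ g *ᵥ n = 0) (hkl : k ⬝ᵥ g *ᵥ l = 1) (hnn : n ⬝ᵥ g *ᵥ n = -(1 / 2))
    (hφ : φ ≠ 0) (hΦk : Φ *ᵥ k = φ • g *ᵥ k)
    (htr : ∑ a, ∑ b, g⁻¹ a b * Φ a b = 0) (hF : ∀ a, k ⬝ᵥ g *ᵥ F a = 0)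
    (hE : ∀ c, -φ * (g *ᵥ ∑ a, k a • F a) c + (Φ *ᵥ ∑ a, k a • F a) c +
      (g *ᵥ k) c * (φ * ∑ a, F a a - ∑ a, ∑ f, g⁻¹ f a * (Φ *ᵥ F a) f) = 0)
    {X Y : Fin 3 → ℂ} (hX : k ⬝ᵥ g *ᵥ X = 0) (hY : k ⬝ᵥ g *ᵥ Y = 0) :
    Y ⬝ᵥ g *ᵥ ∑ a, X a • F a = 0 := by
  have hinv := inverse_eq_of_frame hg hkk hll hkn hln hkl hnn
  have hgg : g⁻¹ * g = 1 := nonsing_inv_mul _ (isUnit_iff_ne_zero.mpr hgdet)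
  -- expansion of a vector in the frame
  have expand : ∀ v : Fin 3 → ℂ, v = (l ⬝ᵥ g *ᵥ v) • k + (k ⬝ᵥ g *ᵥ v) • l -
      (2 * (n ⬝ᵥ g *ᵥ v)) • n := by
    intro v
    have : v = g⁻¹ *ᵥ (g *ᵥ v) := by rw [mulVec_mulVec, hgg, one_mulVec]
    conv_lhs => rw [this]
    ext i
    simp only [mulVec, dotProduct, Fin.sum_univ_three, hinv, Pi.add_apply, Pi.sub_apply,
      Pi.smul_apply, smul_eq_mul]
    ring
  -- contraction with the inverse metric
  have contract : ∀ T : Fin 3 → Fin 3 → ℂ, ∑ a, ∑ f, g⁻¹ f a * T a f =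
      l ⬝ᵥ (∑ a, k a • T a) + k ⬝ᵥ (∑ a, l a • T a) - 2 * n ⬝ᵥ (∑ a, n a • T a) := by
    intro T
    simp only [hinv, dotProduct, Fin.sum_univ_three, Pi.add_apply, Pi.smul_apply, smul_eq_mul]
    ring
  set D : (Fin 3 → ℂ) → Fin 3 → ℂ := fun v => ∑ a, v a • F a with hD
  have mul_D : ∀ (M : Matrix (Fin 3) (Fin 3) ℂ) (v : Fin 3 → ℂ),
      ∑ a, v a • (M *ᵥ F a) = M *ᵥ D v := by
    intro M v; simp only [hD, Matrix.mulVec_sum, Matrix.mulVec_smul]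
  have kD : ∀ v, k ⬝ᵥ g *ᵥ D v = 0 := by
    intro v
    rw [← mul_D, dotProduct_sum]
    exact Finset.sum_eq_zero fun a _ => by rw [dotProduct_smul, hF, smul_zero]
  have Φ_k : ∀ v, v ⬝ᵥ Φ *ᵥ k = φ * (v ⬝ᵥ g *ᵥ k) := by
    intro v; rw [hΦk, dotProduct_smul, smul_eq_mul]
  have k_Φ : ∀ v, k ⬝ᵥ Φ *ᵥ v = φ * (k ⬝ᵥ g *ᵥ v) := by
    intro v; rw [dotProduct_mulVec_comm hΦ, Φ_k, dotProduct_mulVec_comm hg]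
  have hnk : n ⬝ᵥ g *ᵥ k = 0 := by rw [dotProduct_mulVec_comm hg, hkn]
  have hlk : l ⬝ᵥ g *ᵥ k = 1 := by rw [dotProduct_mulVec_comm hg, hkl]
  -- In the frame the vanishing trace reads 2Φ(k,l) - 2Φ(n,n) = 0, and Φ(k,l) = φ.
  have Φ_nn : n ⬝ᵥ Φ *ᵥ n = φ := by
    have h1 := contract fun a f => Φ a f
    have h2 : ∀ v : Fin 3 → ℂ, ∑ a, v a • (fun f => Φ a f) = Φ *ᵥ v := by
      intro v
      conv_rhs => rw [← hΦ]
      ext i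
      simp [mulVec, dotProduct, Fin.sum_univ_three, mul_comm]
    simp only [h2, Φ_k, k_Φ, hkl, hlk] at h1
    have h3 : ∑ a, ∑ f, g⁻¹ f a * Φ a f = 0 := by
      rw [← htr, Finset.sum_comm]
      refine Finset.sum_congr rfl fun a _ => Finset.sum_congr rfl fun b _ => ?_
      rw [show Φ b a = Φ a b from congrFun (congrFun hΦ a) b]
    rw [h3] at h1
    linear_combination (1 / 2) * h1
  set κ := n ⬝ᵥ g *ᵥ D k with hκ
  set ρ := n ⬝ᵥ g *ᵥ D n with hρ
  set E := φ * ∑ a, F a a - ∑ a, ∑ f, g⁻¹ f a * (Φ *ᵥ F a) f with hEdef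
  have hE' : ∀ v : Fin 3 → ℂ, -φ * (v ⬝ᵥ g *ᵥ D k) + v ⬝ᵥ Φ *ᵥ D k + (v ⬝ᵥ g *ᵥ k) * E = 0 := by
    intro v
    have : ∑ c, v c * (-φ * (g *ᵥ D k) c + (Φ *ᵥ D k) c + (g *ᵥ k) c * E) = 0 :=
      Finset.sum_eq_zero fun c _ => by rw [hE c, mul_zero]
    rw [← this]
    simp only [dotProduct, Fin.sum_univ_three]
    ring
  -- the component along `n` gives the vanishing of `κ`
  have Φ_nD : ∀ v, n ⬝ᵥ Φ *ᵥ D v = -2 * φ * (n ⬝ᵥ g *ᵥ D v) := by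
    intro v
    conv_lhs => rw [expand (D v)]
    rw [mulVec_sub, mulVec_add, dotProduct_sub, dotProduct_add, kD]
    simp only [mulVec_smul, dotProduct_smul, smul_eq_mul, Φ_k, hnk, Φ_nn]
    ring
  have κ_zero : κ = 0 := by
    have h1 := hE' n
    rw [Φ_nD, hnk, ← hκ] at h1
    -- The two terms -φκ and -2φκ add up to -3φκ.
    have h2 : φ * κ = 0 := by linear_combination (-1 / 3) * h1
    exact (mul_eq_zero.mp h2).resolve_left hφ
  -- the component along `l` gives the vanishing of `ρ`
  have Dk : D k = (l ⬝ᵥ g *ᵥ D k) • k := by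
    conv_lhs => rw [expand (D k)]
    rw [kD, ← hκ, κ_zero]; simp
  have Φ_lDk : l ⬝ᵥ Φ *ᵥ D k = φ * (l ⬝ᵥ g *ᵥ D k) := by
    conv_lhs => rw [Dk]
    rw [mulVec_smul, dotProduct_smul, Φ_k, hlk]
    simp [mul_comm]
  have E_zero : E = 0 := by
    have h1 := hE' l
    rw [Φ_lDk, hlk] at h1
    linear_combination h1
  have div_eq : ∑ a, F a a = l ⬝ᵥ g *ᵥ D k - 2 * ρ := by
    have h1 := contract fun a => g *ᵥ F a
    simp only [mul_D, kD] at h1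
    have h2 : ∀ a, ∑ f, g⁻¹ f a * (g *ᵥ F a) f = F a a := by
      intro a
      have h3 : ∑ f, g⁻¹ a f * (g *ᵥ F a) f = F a a := by
        change (g⁻¹ *ᵥ (g *ᵥ F a)) a = F a a
        rw [mulVec_mulVec, hgg, one_mulVec]
      rw [← h3]
      refine Finset.sum_congr rfl fun f _ => ?_
      congr 1
      rw [hinv, hinv]; ring
    simp only [h2] at h1
    rw [h1, ← hρ]; ring
  have ρ_zero : ρ = 0 := by
    have h1 := contract fun a => Φ *ᵥ F a
    simp only [mul_D, k_Φ, kD, Φ_lDk, Φ_nD, ← hρ] at h1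
    rw [hEdef, h1, div_eq] at E_zero
    -- The divergence is λ - 2ρ and the contraction of Φ with ∇k is φλ + 4φρ, where λ = g(l, ∇_k k);
    -- thus E = -6φρ.
    have h2 : φ * ρ = 0 := by linear_combination (-1 / 6) * E_zero
    exact (mul_eq_zero.mp h2).resolve_left hφ
  have X_eq : X = (l ⬝ᵥ g *ᵥ X) • k - (2 * (n ⬝ᵥ g *ᵥ X)) • n := by
    conv_lhs => rw [expand X]
    rw [hX]; simp
  have Y_eq : Y = (l ⬝ᵥ g *ᵥ Y) • k - (2 * (n ⬝ᵥ g *ᵥ Y)) • n := by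
    conv_lhs => rw [expand Y]
    rw [hY]; simp
  have D_X : D X = (l ⬝ᵥ g *ᵥ X) • D k - (2 * (n ⬝ᵥ g *ᵥ X)) • D n := by
    conv_lhs => rw [X_eq]
    simp only [hD, Fin.sum_univ_three, Pi.sub_apply, Pi.smul_apply, smul_eq_mul]
    ext i
    simp only [Pi.add_apply, Pi.sub_apply, Pi.smul_apply, smul_eq_mul]
    ring
  show Y ⬝ᵥ g *ᵥ D X = 0
  rw [Y_eq, sub_dotProduct, smul_dotProduct, smul_dotProduct, kD, D_X, mulVec_sub, mulVec_smul,
    mulVec_smul, dotProduct_sub, dotProduct_smul, dotProduct_smul, ← hκ, ← hρ, κ_zero, ρ_zero]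
  simp

end Pointwise

/-! ### The Cotton tensor condition in a coordinate domain -/

section CoordinateCotton

open Matrix

namespace IsMetricOn

variable {G : E3 → Matrix (Fin 3) (Fin 3) ℂ} {V : Set E3} (h : IsMetricOn G V)
include h

theorem tracefreeRicci_symm {y : E3} (hy : y ∈ V) (a b : Fin 3) :
    tracefreeRicci G a b y = tracefreeRicci G b a y := by
  unfold tracefreeRicci; rw [h.ricci_symm hy, h.symm]

theorem sum_inv_mul_metric {y : E3} (hy : y ∈ V) :
    ∑ a, ∑ b, (G y)⁻¹ a b * G y a b = 3 := by
  have h1 : ∀ a, ∑ b, (G y)⁻¹ a b * G y a b = 1 := by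
    intro a
    have h2 : (G y)⁻¹ * G y = 1 := mul_eq_one_comm.mp (h.mul_inv hy)
    have h3 := congrFun (congrFun h2 a) a
    rw [Matrix.mul_apply, Matrix.one_apply_eq] at h3
    rw [← h3]
    exact Finset.sum_congr rfl fun b _ => by rw [h.symm]
  simp [h1]

theorem trace_tracefreeRicci {y : E3} (hy : y ∈ V) :
    ∑ a, ∑ b, (G y)⁻¹ a b * tracefreeRicci G a b y = 0 := by
  have h1 : ∑ a, ∑ b, (G y)⁻¹ a b * tracefreeRicci G a b y = scalar G y -
      (1 / 3) * scalar G y * ∑ a, ∑ b, (G y)⁻¹ a b * G y a b := by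
    simp only [tracefreeRicci, scalar, Finset.mul_sum, ← Finset.sum_sub_distrib, mul_sub]
    simp only [Fin.sum_univ_three]
    ring
  rw [h1, h.sum_inv_mul_metric hy]
  ring

/-- Since ∇g = 0, only the scalar factor of a multiple of the metric is differentiated. -/
theorem covDeriv2_sub_mul_metric {T T' : Fin 3 → Fin 3 → E3 → ℂ} {s : E3 → ℂ}
    (hT : ∀ a b, ContDiffOn ℝ ∞ (T a b) V) (hs : ContDiffOn ℝ ∞ s V)
    (hT' : ∀ a b x, T' a b x = T a b x - s x * G x a b) {y : E3} (hy : y ∈ V) (b c a : Fin 3) :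
    covDeriv2 G T' b c a y = covDeriv2 G T b c a y - pd b s y * G y c a := by
  have hd : ∀ {f : E3 → ℂ}, ContDiffOn ℝ ∞ f V → DifferentiableAt ℝ f y :=
    fun hf => differentiableAt_of_contDiffOn h.isOpen hf hy
  have e : pd b (T' c a) y = pd b (T c a) y - (s y * pd b (fun x => G x c a) y +
      G y c a * pd b s y) := by
    rw [← pd_mul b (hd hs) (hd (h.smooth c a)), ← pd_sub b (hd (hT c a))
      (hd (hs.mul (h.smooth c a)))]
    exact congrArg (fun f => pd b f y) (funext fun x => hT' c a x)
  unfold covDeriv2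
  rw [e, h.pd_metric hy]
  simp only [hT', Fin.sum_univ_three]
  ring

theorem covDeriv2_tracefreeRicci {y : E3} (hy : y ∈ V) (b c a : Fin 3) :
    covDeriv2 G (tracefreeRicci G) b c a y =
      covDeriv2 G (ricci G) b c a y - (1 / 3) * pd b (scalar G) y * G y c a := by
  rw [h.covDeriv2_sub_mul_metric (T' := tracefreeRicci G) (s := fun x => (1 / 3) * scalar G x) h.smooth_ricci
    (contDiffOn_const.mul h.smooth_scalar) (fun _ _ _ => rfl) hy,
    pd_const_mul _ _ (differentiableAt_of_contDiffOn h.isOpen h.smooth_scalar hy)]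

theorem pd_scalarS {y : E3} (hy : y ∈ V) (a : Fin 3) :
    pd a (scalarS G) y = (1 / 12) * pd a (scalar G) y :=
  pd_const_mul _ _ (differentiableAt_of_contDiffOn h.isOpen h.smooth_scalar hy)

/-- The divergence of Ricci is ½∂R and that of the trace part is ⅓∂R; the difference ⅙∂R equals 2∂S.
-/
theorem divergence_tracefreeRicci {y : E3} (hy : y ∈ V) (e : Fin 3) :
    ∑ a, ∑ f, covDeriv2 G (tracefreeRicci G) a e f y * (G y)⁻¹ f a = 2 * pd e (scalarS G) y := by
  have h1 := h.divergence_ricci hy e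
  have h2 : ∑ a, ∑ f, covDeriv2 G (tracefreeRicci G) a e f y * (G y)⁻¹ f a =
      ∑ a, ∑ f, covDeriv2 G (ricci G) a e f y * (G y)⁻¹ f a -
        (1 / 3) * ∑ a, pd a (scalar G) y * (G y * (G y)⁻¹) e a := by
    simp only [h.covDeriv2_tracefreeRicci hy, sub_mul, Finset.sum_sub_distrib, Matrix.mul_apply,
      Finset.mul_sum]
    congr 1
    exact Finset.sum_congr rfl fun a _ => Finset.sum_congr rfl fun f _ => by ring
  rw [h2, h.mul_inv hy, h.pd_scalarS hy]
  simp only [Matrix.one_apply, mul_ite, mul_one, mul_zero, Finset.sum_ite_eq, Finset.mem_univ,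
    if_true]
  linear_combination (1 / 2) * h1

theorem cotton_eq {y : E3} (hy : y ∈ V) (a b c : Fin 3) :
    cotton G a b c y = -covDeriv2 G (tracefreeRicci G) b c a y
      + covDeriv2 G (tracefreeRicci G) c b a y
      - pd b (scalarS G) y * G y c a + pd c (scalarS G) y * G y b a := by
  have hs : ContDiffOn ℝ ∞ (scalarS G) V := contDiffOn_const.mul h.smooth_scalar
  have key : ∀ i j k, covDeriv2 G (schouten G) i j k y =
      -covDeriv2 G (tracefreeRicci G) i j k y - pd i (scalarS G) y * G y j k := by
    intro i j k
    rw [h.covDeriv2_sub_mul_metric (T' := schouten G) (T := fun a b x => -tracefreeRicci G a b x) (s := scalarS G)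
      (fun a b => (h.smooth_tracefreeRicci a b).neg) hs (fun _ _ _ => rfl) hy]
    congr 1
    simp only [covDeriv2, pd_neg, Fin.sum_univ_three]
    ring
  rw [cotton, key, key]
  ring

variable {K : Fin 3 → E3 → ℂ} {φ : E3 → ℂ}

/-- The Leibniz rule applied to the eigenvector equation. This is what removes derivatives of the
curvature in favour of ∂φ and ∇K. -/
theorem covDeriv2_tracefreeRicci_mul (hK : ∀ i, ContDiffOn ℝ ∞ (K i) V)
    (hφ : ContDiffOn ℝ ∞ φ V)
    (hΦ : ∀ y ∈ V, ∀ a, ∑ b, tracefreeRicci G a b y * K b y = φ y * ∑ b, G y a b * K b y)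
    {y : E3} (hy : y ∈ V) (c a : Fin 3) :
    ∑ b, covDeriv2 G (tracefreeRicci G) c a b y * K b y = pd c φ y * ∑ b, G y a b * K b y +
      φ y * ∑ b, G y a b * covDerivVec G (Pi.single c 1) K b y -
      ∑ b, tracefreeRicci G a b y * covDerivVec G (Pi.single c 1) K b y := by
  have hd : ∀ {f : E3 → ℂ}, ContDiffOn ℝ ∞ f V → DifferentiableAt ℝ f y :=
    fun hf => differentiableAt_of_contDiffOn h.isOpen hf hy
  have hT := h.smooth_tracefreeRicci
  have key := pd_congr_on h.isOpen c (fun x hx => hΦ x hx a) hy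
  rw [pd_sum c fun b => hd ((hT a b).mul (hK b)),
    pd_mul c (hd hφ) (hd (ContDiffOn.sum fun b _ => (h.smooth a b).mul (hK b))),
    pd_sum c fun b => hd ((h.smooth a b).mul (hK b))] at key
  have e1 : ∀ b, pd c (fun x => tracefreeRicci G a b x * K b x) y =
      tracefreeRicci G a b y * pd c (K b) y + K b y * pd c (tracefreeRicci G a b) y :=
    fun b => pd_mul c (hd (hT a b)) (hd (hK b))
  have e2 : ∀ b, pd c (fun x => G x a b * K b x) y =
      G y a b * pd c (K b) y + K b y * pd c (fun x => G x a b) y :=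
    fun b => pd_mul c (hd (h.smooth a b)) (hd (hK b))
  have e3 : ∀ b, covDerivVec G (Pi.single c 1) K b y =
      pd c (K b) y + ∑ d, christoffel G b c d y * K d y := by
    intro b
    simp [covDerivVec, Pi.single_apply]
  simp only [e1, e2, h.pd_metric hy] at key
  simp only [e3, covDeriv2]
  have q := hΦ y hy
  simp only [Fin.sum_univ_three] at key q ⊢
  -- The Christoffel terms acting on the free index a are absorbed by the undifferentiated
  -- eigenvector equation.
  linear_combination key - christoffel G 0 c a y * q 0 - christoffel G 1 c a y * q 1 -
    christoffel G 2 c a y * q 2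

theorem pd_metric_apply {K' : Fin 3 → E3 → ℂ} (hK : ∀ i, ContDiffOn ℝ ∞ (K i) V)
    (hK' : ∀ i, ContDiffOn ℝ ∞ (K' i) V)
    (h0 : ∀ y ∈ V, ∑ a, ∑ b, G y a b * K a y * K' b y = 0) {y : E3} (hy : y ∈ V)
    (X : Fin 3 → ℂ) :
    ∑ a, ∑ b, G y a b * covDerivVec G X K a y * K' b y +
      ∑ a, ∑ b, G y a b * K a y * covDerivVec G X K' b y = 0 := by
  have hd : ∀ {f : E3 → ℂ}, ContDiffOn ℝ ∞ f V → DifferentiableAt ℝ f y :=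
    fun hf => differentiableAt_of_contDiffOn h.isOpen hf hy
  have key : ∀ c, ∑ a, ∑ b, (G y a b * (K a y * pd c (K' b) y) +
      G y a b * (K' b y * pd c (K a) y) + K a y * K' b y * pd c (fun x => G x a b) y) = 0 := by
    intro c
    have hsm : ∀ a b, ContDiffOn ℝ ∞ (fun x => G x a b * (K a x * K' b x)) V :=
      fun a b => (h.smooth a b).mul ((hK a).mul (hK' b))
    have h1 : ∀ x ∈ V, ∑ a, ∑ b, G x a b * (K a x * K' b x) = 0 := by
      intro x hx
      rw [← h0 x hx]
      exact Finset.sum_congr rfl fun a _ => Finset.sum_congr rfl fun b _ => by ring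
    have h2 := pd_congr_on h.isOpen c h1 hy
    have h3 : pd c (fun _ : E3 => (0 : ℂ)) y = 0 := by simp [pd]
    rw [pd_sum c fun a => hd (ContDiffOn.sum fun b _ => hsm a b), h3] at h2
    rw [← h2]
    refine Finset.sum_congr rfl fun a _ => ?_
    rw [pd_sum c fun b => hd (hsm a b)]
    refine Finset.sum_congr rfl fun b _ => ?_
    rw [pd_mul c (hd (h.smooth a b)) (hd ((hK a).mul (hK' b))), pd_mul c (hd (hK a)) (hd (hK' b))]
    ring
  simp only [h.pd_metric hy] at key
  simp only [Fin.sum_univ_three] at key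
  simp only [covDerivVec, Fin.sum_univ_three]
  linear_combination X 0 * key 0 + X 1 * key 1 + X 2 * key 2

end IsMetricOn

end CoordinateCotton

/-! ### Elimination of the derivatives of curvature along the null direction -/

section CoordinateTheorem

open Matrix

namespace IsMetricOn

variable {G : E3 → Matrix (Fin 3) (Fin 3) ℂ} {V : Set E3} (h : IsMetricOn G V)
  {K : Fin 3 → E3 → ℂ} {φ : E3 → ℂ}
include h

theorem covDeriv2_tracefreeRicci_symm {y : E3} (hy : y ∈ V) (c a b : Fin 3) :
    covDeriv2 G (tracefreeRicci G) c a b y = covDeriv2 G (tracefreeRicci G) c b a y := by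
  have hs : ∀ {x}, x ∈ V → ∀ a b, tracefreeRicci G a b x = tracefreeRicci G b a x :=
    fun hx => h.tracefreeRicci_symm hx
  have e : pd c (tracefreeRicci G a b) y = pd c (tracefreeRicci G b a) y :=
    pd_congr_on h.isOpen c (fun x hx => hs hx a b) hy
  unfold covDeriv2
  rw [e]
  simp only [Fin.sum_univ_three, hs hy a, hs hy b]
  ring

/-- The contracted Bianchi identity along an eigenvector field `K` of the tracefree Ricci tensor. -/
theorem two_mul_pd_scalarS (hK : ∀ i, ContDiffOn ℝ ∞ (K i) V) (hφ : ContDiffOn ℝ ∞ φ V)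
    (hΦ : ∀ y ∈ V, ∀ a, ∑ b, tracefreeRicci G a b y * K b y = φ y * ∑ b, G y a b * K b y)
    {y : E3} (hy : y ∈ V) :
    2 * ∑ a, K a y * pd a (scalarS G) y = ∑ a, pd a φ y * K a y +
      φ y * ∑ a, covDerivVec G (Pi.single a 1) K a y -
      ∑ a, ∑ f, (G y)⁻¹ f a * ∑ b, tracefreeRicci G f b y * covDerivVec G (Pi.single a 1) K b y := by
  have hinv : ∀ (v : Fin 3 → ℂ) a, ∑ f, (G y)⁻¹ f a * ∑ b, G y f b * v b = v a := by
    intro v a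
    have h1 : ((G y)⁻¹ *ᵥ (G y *ᵥ v)) a = v a := by
      rw [mulVec_mulVec, mul_eq_one_comm.mp (h.mul_inv hy), one_mulVec]
    rw [← h1]
    simp only [h.inv_symm hy _ a]
    rfl
  calc 2 * ∑ a, K a y * pd a (scalarS G) y
      = ∑ e, K e y * ∑ a, ∑ f, covDeriv2 G (tracefreeRicci G) a e f y * (G y)⁻¹ f a := by
        simp only [h.divergence_tracefreeRicci hy, Finset.mul_sum]
        exact Finset.sum_congr rfl fun a _ => by ring
    _ = ∑ a, ∑ f, (G y)⁻¹ f a * ∑ e, covDeriv2 G (tracefreeRicci G) a f e y * K e y := by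
        simp only [Finset.mul_sum]
        rw [Finset.sum_comm]
        refine Finset.sum_congr rfl fun a _ => ?_
        rw [Finset.sum_comm]
        refine Finset.sum_congr rfl fun f _ => Finset.sum_congr rfl fun e _ => ?_
        -- Symmetry of ∇Φ moves K to the last slot, where the differentiated eigenvector equation
        -- applies.
        rw [h.covDeriv2_tracefreeRicci_symm hy a e f]
        ring
    _ = ∑ a, (pd a φ y * K a y + φ y * covDerivVec G (Pi.single a 1) K a y -
          ∑ f, (G y)⁻¹ f a *
            ∑ b, tracefreeRicci G f b y * covDerivVec G (Pi.single a 1) K b y) := by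
        refine Finset.sum_congr rfl fun a _ => ?_
        rw [← hinv (fun b => K b y) a, ← hinv (fun b => covDerivVec G (Pi.single a 1) K b y) a,
          Finset.mul_sum, Finset.mul_sum, ← Finset.sum_add_distrib, ← Finset.sum_sub_distrib]
        refine Finset.sum_congr rfl fun f _ => ?_
        rw [h.covDeriv2_tracefreeRicci_mul hK hφ hΦ hy]
        ring
    _ = _ := by rw [Finset.sum_sub_distrib, Finset.sum_add_distrib, Finset.mul_sum]

/-- The Goldberg-Sachs type theorem in a coordinate domain. -/
theorem metric_covDerivVec_eq_zero (hK : ∀ i, ContDiffOn ℝ ∞ (K i) V) (hφ : ContDiffOn ℝ ∞ φ V)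
    (hΦ : ∀ y ∈ V, ∀ a, ∑ b, tracefreeRicci G a b y * K b y = φ y * ∑ b, G y a b * K b y)
    (hKK : ∀ y ∈ V, ∑ a, ∑ b, G y a b * K a y * K b y = 0)
    {y : E3} (hy : y ∈ V) (hφy : φ y ≠ 0) {k l n : Fin 3 → ℂ} (hk : ∀ i, k i = K i y)
    (hll : l ⬝ᵥ G y *ᵥ l = 0) (hkn : k ⬝ᵥ G y *ᵥ n = 0)
    (hln : l ⬝ᵥ G y *ᵥ n = 0) (hkl : k ⬝ᵥ G y *ᵥ l = 1) (hnn : n ⬝ᵥ G y *ᵥ n = -(1 / 2))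
    (hA : ∀ c, ∑ a, ∑ b, k a * k b *
      (cotton G a b c y + 3 * G y b c * pd a (scalarS G) y) = 0)
    {X Y : Fin 3 → ℂ} (hX : k ⬝ᵥ G y *ᵥ X = 0) (hY : k ⬝ᵥ G y *ᵥ Y = 0) :
    Y ⬝ᵥ G y *ᵥ (fun c => covDerivVec G X K c y) = 0 := by
  obtain rfl : k = fun i => K i y := funext hk
  set Φ : Matrix (Fin 3) (Fin 3) ℂ := Matrix.of fun a b => tracefreeRicci G a b y with hΦdef
  set F : Fin 3 → Fin 3 → ℂ := fun a c => covDerivVec G (Pi.single a 1) K c y with hFdef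
  have hD : ∀ X : Fin 3 → ℂ, (fun c => covDerivVec G X K c y) = ∑ a, X a • F a := by
    intro X
    ext c
    simp [hFdef, covDerivVec, Pi.single_apply]
  have hkk : (fun i => K i y) ⬝ᵥ G y *ᵥ (fun i => K i y) = 0 := by
    rw [← hKK y hy]
    simp only [mulVec, dotProduct, Fin.sum_univ_three]
    ring
  -- Differentiating g(K,K) = 0 gives g(K, ∇_a K) = 0; `hΦF` below is the same statement for Φ by
  -- the eigenvector equation.
  have hF : ∀ a, (fun i => K i y) ⬝ᵥ G y *ᵥ F a = 0 := by
    intro a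
    have h1 := h.pd_metric_apply hK hK hKK hy (Pi.single a 1)
    have h2 : 2 * ((fun i => K i y) ⬝ᵥ G y *ᵥ F a) = 0 := by
      rw [← h1]
      simp only [hFdef, mulVec, dotProduct, Fin.sum_univ_three, h.symm y 1 0, h.symm y 2 0,
        h.symm y 2 1]
      ring
    exact (mul_eq_zero.mp h2).resolve_left two_ne_zero
  have hΦt : Φᵀ = Φ := by
    ext a b; exact h.tracefreeRicci_symm hy b a
  have hΦk : Φ *ᵥ (fun i => K i y) = φ y • G y *ᵥ (fun i => K i y) := by
    ext a; exact hΦ y hy a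
  have hΦF : ∀ a, (fun i => K i y) ⬝ᵥ Φ *ᵥ F a = 0 := by
    intro a
    rw [dotProduct_mulVec_comm hΦt, hΦk, dotProduct_smul,
      dotProduct_mulVec_comm (h.transpose_eq y), hF, smul_zero]
  rw [hD]
  refine dotProduct_covDeriv_eq_zero (h.transpose_eq y) (h.det_ne_zero y hy) hΦt hkk hll hkn hln
    hkl hnn hφy hΦk (h.trace_tracefreeRicci hy) hF ?_ hX hY
  intro c
  have hS := h.two_mul_pd_scalarS hK hφ hΦ hy
  set E := φ y * ∑ a, F a a - ∑ a, ∑ f, (G y)⁻¹ f a * (Φ *ᵥ F a) f with hE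
  have hS' : 2 * ∑ a, K a y * pd a (scalarS G) y = ∑ a, pd a φ y * K a y + E := by
    rw [hS, hE]; exact add_sub_assoc _ _ _
  have hT : ∀ c a, ∑ b, covDeriv2 G (tracefreeRicci G) c a b y * K b y =
      pd c φ y * (G y *ᵥ fun i => K i y) a + φ y * (G y *ᵥ F c) a - (Φ *ᵥ F c) a :=
    fun c a => h.covDeriv2_tracefreeRicci_mul hK hφ hΦ hy c a
  have t1 : ∑ a, ∑ b, K a y * K b y * covDeriv2 G (tracefreeRicci G) b c a y =
      (∑ a, pd a φ y * K a y) * (G y *ᵥ fun i => K i y) c +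
        φ y * (G y *ᵥ ∑ a, K a y • F a) c - (Φ *ᵥ ∑ a, K a y • F a) c := by
    have e : ∑ a, ∑ b, K a y * K b y * covDeriv2 G (tracefreeRicci G) b c a y =
        ∑ b, K b y * ∑ a, covDeriv2 G (tracefreeRicci G) b c a y * K a y := by
      rw [Finset.sum_comm]
      simp only [Finset.mul_sum]
      exact Finset.sum_congr rfl fun a _ => Finset.sum_congr rfl fun b _ => by ring
    rw [e]
    simp only [hT, Matrix.mulVec_sum, Matrix.mulVec_smul, Finset.sum_apply, Pi.smul_apply,
      smul_eq_mul]
    simp only [Fin.sum_univ_three]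
    ring
  have t2 : ∑ a, ∑ b, K a y * K b y * covDeriv2 G (tracefreeRicci G) c b a y = 0 := by
    have e : ∑ a, ∑ b, K a y * K b y * covDeriv2 G (tracefreeRicci G) c b a y =
        ∑ b, K b y * ∑ a, covDeriv2 G (tracefreeRicci G) c b a y * K a y := by
      rw [Finset.sum_comm]
      simp only [Finset.mul_sum]
      exact Finset.sum_congr rfl fun a _ => Finset.sum_congr rfl fun b _ => by ring
    rw [e]
    simp only [hT]
    have e2 : ∑ b, K b y * (pd c φ y * (G y *ᵥ fun i => K i y) b + φ y * (G y *ᵥ F c) b -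
        (Φ *ᵥ F c) b) = pd c φ y * ((fun i => K i y) ⬝ᵥ G y *ᵥ fun i => K i y) +
          φ y * ((fun i => K i y) ⬝ᵥ G y *ᵥ F c) - (fun i => K i y) ⬝ᵥ Φ *ᵥ F c := by
      simp only [dotProduct, Fin.sum_univ_three]
      ring
    rw [e2, hkk, hF, hΦF]
    ring
  have h1 := hA c
  simp only [h.cotton_eq hy] at h1
  -- The coefficient 3 combines with the -1 coming from the Schouten tensor to give exactly the 2 of
  -- the Bianchi identity, so that `linear_combination` cancels the derivatives of φ against those
  -- of S.
  have e : ∑ a, ∑ b, K a y * K b y * (-covDeriv2 G (tracefreeRicci G) b c a y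
      + covDeriv2 G (tracefreeRicci G) c b a y
      - pd b (scalarS G) y * G y c a + pd c (scalarS G) y * G y b a +
      3 * G y b c * pd a (scalarS G) y) =
      -(∑ a, ∑ b, K a y * K b y * covDeriv2 G (tracefreeRicci G) b c a y) +
      ∑ a, ∑ b, K a y * K b y * covDeriv2 G (tracefreeRicci G) c b a y +
      pd c (scalarS G) y * ((fun i => K i y) ⬝ᵥ G y *ᵥ fun i => K i y) +
      (G y *ᵥ fun i => K i y) c * (2 * ∑ a, K a y * pd a (scalarS G) y) := by
    simp only [mulVec, dotProduct, Fin.sum_univ_three, h.symm y _ c]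
    ring
  rw [e, t1, t2, hkk, hS'] at h1
  linear_combination h1

end IsMetricOn

end CoordinateTheorem

/-! ### Components in a chart -/

section Charts

open Matrix

variable {M : Type*} [TopologicalSpace M] [ChartedSpace E3 M]
  {e : OpenPartialHomeomorph M E3} (g : ComplexMetric M)

/-- The tuple of components of a complex tangent vector in the chart `e`. -/
noncomputable def coords (e : OpenPartialHomeomorph M E3) (p : M) (v : CTangent p) : Fin 3 → ℂ :=
  fun i => coord e p i v

theorem coords_smul (e : OpenPartialHomeomorph M E3) (p : M) (c : ℂ) (v : CTangent p) :
    coords e p (c • v) = c • coords e p v := by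
  ext i; simp [coords]

theorem phiForm_eq_dotProduct {y : E3} (hy : y ∈ e.target) (v w : CTangent (e.symm y)) :
    phiForm g e (e.symm y) v w = coords e _ v ⬝ᵥ
      (Matrix.of fun a b => tracefreeRicci (g.comp e) a b y) *ᵥ coords e _ w := by
  simp only [phiForm, e.right_inv hy, dotProduct, mulVec, coords, Matrix.of_apply, Finset.mul_sum]
  exact Finset.sum_congr rfl fun i _ => Finset.sum_congr rfl fun j _ => by ring

theorem metricCovDeriv_eq_dotProduct {y : E3} (hy : y ∈ e.target) (X : CTangent (e.symm y))
    (Y : ∀ q : M, CTangent q) (Z : CTangent (e.symm y)) :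
    metricCovDeriv g e (e.symm y) X Y Z = (fun c => covDerivVec (g.comp e) (coords e _ X)
      (fieldComp e Y) c y) ⬝ᵥ g.comp e y *ᵥ coords e _ Z := by
  simp only [metricCovDeriv, e.right_inv hy, dotProduct, mulVec, Finset.mul_sum]
  exact Finset.sum_congr rfl fun i _ => Finset.sum_congr rfl fun j _ =>
    (mul_assoc _ _ _).trans (mul_left_comm _ _ _)

variable [IsManifold 𝓘(ℝ, E3) ∞ M]

theorem mdifferentiable_chart (he : e ∈ atlas E3 M) : e.MDifferentiable 𝓘(ℝ, E3) 𝓘(ℝ, E3) :=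
  haveI : IsManifold 𝓘(ℝ, E3) 1 M := IsManifold.of_le (n := ∞) (by simp)
  mdifferentiable_of_mem_atlas he

theorem coord_coordVec (he : e ∈ atlas E3 M) {y : E3} (hy : y ∈ e.target) (i j : Fin 3) :
    coord e (e.symm y) i (coordVec e y j) = if i = j then 1 else 0 := by
  have h1 := DFunLike.congr_fun ((mdifferentiable_chart he).comp_symm_deriv hy)
    (EuclideanSpace.single j (1 : ℝ))
  have h2 : realCoord e (e.symm y) i (mfderiv 𝓘(ℝ, E3) 𝓘(ℝ, E3) e.symm y
      (EuclideanSpace.single j (1 : ℝ) : E3)) = (EuclideanSpace.single j (1 : ℝ) : E3) i :=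
    congrArg (fun v : E3 => v i) h1
  simp only [coord, coordVec, LinearMap.comp_apply, LinearMap.baseChange_tmul, h2]
  by_cases hij : i = j <;> simp [hij]

theorem sum_coord_smul (he : e ∈ atlas E3 M) {y : E3} (hy : y ∈ e.target)
    (v : CTangent (e.symm y)) : ∑ i, coord e (e.symm y) i v • coordVec e y i = v := by
  have hx : e.symm y ∈ e.source := e.map_target hy
  induction v using TensorProduct.induction_on with
  | zero => simp
  | add v w hv hw => simp only [map_add, add_smul, Finset.sum_add_distrib, hv, hw]
  | tmul c u =>
    have h1 := DFunLike.congr_fun ((mdifferentiable_chart he).symm_comp_deriv hx) u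
    rw [e.right_inv hy] at h1
    -- On a pure tensor the claim reduces to expanding a real tangent vector in the coordinate
    -- frame, the two chart differentials being mutually inverse.
    have h2 : ∑ i, realCoord e (e.symm y) i u • (mfderiv 𝓘(ℝ, E3) 𝓘(ℝ, E3) e.symm y
      (EuclideanSpace.single i (1 : ℝ) : E3)) = u := by
      have hL : ∀ (L : E3 →L[ℝ] E3) (w : E3),
          ∑ i, w i • L (EuclideanSpace.single i (1 : ℝ)) = L w := by
        intro L w
        simp only [← map_smul, ← map_sum]
        congr 1
        ext i
        simp [Pi.single_apply]
      exact (hL (mfderiv 𝓘(ℝ, E3) 𝓘(ℝ, E3) e.symm y)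
        (mfderiv 𝓘(ℝ, E3) 𝓘(ℝ, E3) e (e.symm y) u)).trans h1
    conv_rhs => rw [← h2]
    rw [TensorProduct.tmul_sum]
    refine Finset.sum_congr rfl fun i _ => ?_
    simp only [coord, coordVec, LinearMap.comp_apply, LinearMap.baseChange_tmul]
    simp [TensorProduct.smul_tmul']

theorem form_eq_dotProduct (he : e ∈ atlas E3 M) {y : E3} (hy : y ∈ e.target)
    (v w : CTangent (e.symm y)) :
    g.form (e.symm y) v w = coords e _ v ⬝ᵥ g.comp e y *ᵥ coords e _ w := by
  conv_lhs => rw [← sum_coord_smul he hy v, ← sum_coord_smul he hy w]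
  simp only [map_sum, map_smul, LinearMap.sum_apply, LinearMap.smul_apply, smul_eq_mul]
  simp only [dotProduct, mulVec, coords, ComplexMetric.comp, Matrix.of_apply, Finset.mul_sum]
  rw [Finset.sum_comm]
  exact Finset.sum_congr rfl fun i _ => Finset.sum_congr rfl fun j _ => by ring

theorem isMetricOn_comp (he : e ∈ atlas E3 M) : IsMetricOn (g.comp e) e.target where
  isOpen := e.open_target
  smooth := g.smooth e he
  symm := fun y i j => (g.symm (e.symm y)).eq _ _
  det_ne_zero := by
    intro y hy hdet
    -- A kernel vector of the component matrix would be the coordinate tuple of a tangent vector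
    -- orthogonal to everything.
    obtain ⟨x, hx0, hx⟩ := Matrix.exists_mulVec_eq_zero_iff.mpr hdet
    set v : CTangent (e.symm y) := ∑ i, x i • coordVec e y i with hv
    have hvx : coords e _ v = x := by
      ext i
      simp [coords, hv, coord_coordVec he hy]
    have hv0 : v = 0 := by
      refine (g.nondegenerate (e.symm y)).2 v fun w => ?_
      rw [form_eq_dotProduct g he hy, hvx, hx, dotProduct_zero]
    apply hx0
    rw [← hvx, hv0]
    ext i
    simp [coords]

end Charts

/-! ### Null structures -/

section NullStructures

open Matrix

variable {M : Type*} [TopologicalSpace M] [ChartedSpace E3 M]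
  {e : OpenPartialHomeomorph M E3} {g : ComplexMetric M} {N : NullStructure g}

theorem NullStructure.exists_smul_eq (N : NullStructure g) {p : M} {k v : CTangent p}
    (hk : k ∈ N.fiber p) (hk0 : k ≠ 0) (hv : v ∈ N.fiber p) : ∃ c : ℂ, c • k = v := by
  have hk' : (⟨k, hk⟩ : N.fiber p) ≠ 0 := fun h => hk0 (congrArg Subtype.val h)
  obtain ⟨c, hc⟩ := (finrank_eq_one_iff_of_nonzero' _ hk').mp (N.finrank_eq_one p) ⟨v, hv⟩
  exact ⟨c, congrArg Subtype.val hc⟩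

theorem NullStructure.IsAdaptedFrame.ne_zero {p : M} {k l n : CTangent p}
    (hf : N.IsAdaptedFrame p k l n) : k ≠ 0 := by
  rintro rfl
  simpa using hf.kl

/-- Rescaling an adapted frame to a prescribed generator. -/
theorem NullStructure.IsAdaptedFrame.rescale {p : M} {k l n v : CTangent p}
    (hf : N.IsAdaptedFrame p k l n) (hv : v ∈ N.fiber p) (hv0 : v ≠ 0) :
    ∃ c : ℂ, c ≠ 0 ∧ v = c • k ∧ N.IsAdaptedFrame p v (c⁻¹ • l) n := by
  obtain ⟨c, rfl⟩ := N.exists_smul_eq hf.mem hf.ne_zero hv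
  have hc : c ≠ 0 := by rintro rfl; simp at hv0
  refine ⟨c, hc, rfl, hv, ?_, ?_, ?_, ?_, ?_, hf.nn⟩
  · simp [hf.kk]
  · simp [hf.ll]
  · simp [hf.kn]
  · simp [hf.ln]
  · simp [hf.kl, hc]

theorem phiForm_smul_left (p : M) (c : ℂ) (v w : CTangent p) :
    phiForm g e p (c • v) w = c * phiForm g e p v w := by
  simp only [phiForm, map_smul, smul_eq_mul, Finset.mul_sum]
  exact Finset.sum_congr rfl fun i _ => Finset.sum_congr rfl fun j _ => by ring

theorem phiForm_smul_right (p : M) (c : ℂ) (v w : CTangent p) :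
    phiForm g e p v (c • w) = c * phiForm g e p v w := by
  simp only [phiForm, map_smul, smul_eq_mul, Finset.mul_sum]
  exact Finset.sum_congr rfl fun i _ => Finset.sum_congr rfl fun j _ => by ring

theorem NullStructure.IsMultiplePrincipal.exists_frame (hN : N.IsMultiplePrincipal)
    (he : e ∈ atlas E3 M) {p : M} (hp : p ∈ e.source) {k : CTangent p} (hk : k ∈ N.fiber p)
    (hk0 : k ≠ 0) : ∃ l n : CTangent p, N.IsAdaptedFrame p k l n ∧
      phiForm g e p k k = 0 ∧ phiForm g e p k n = 0 := by
  obtain ⟨k', l', n', hf, hdvd⟩ := hN p e he hp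
  -- Divisibility by X² means that the coefficients of degree 0 and 1 vanish, namely Φ₀ and 4Φ₁;
  -- rescaling the frame preserves this.
  rw [show (2 : ℕ∞) = (2 : ℕ) from rfl, ← pow_dvd_iff_le_emultiplicity,
    Polynomial.X_pow_dvd_iff] at hdvd
  have h0 := hdvd 0 (by norm_num)
  have h1 := hdvd 1 (by norm_num)
  simp only [ricciPolynomial, Polynomial.coeff_add, Polynomial.coeff_C_mul, Polynomial.coeff_C,
    Polynomial.coeff_X, Polynomial.coeff_X_pow] at h0 h1
  norm_num at h0 h1
  obtain ⟨c, hc, rfl, hf'⟩ := hf.rescale hk hk0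
  refine ⟨_, _, hf', ?_, ?_⟩
  · rw [phiForm_smul_left, phiForm_smul_right, h0]; simp
  · rw [phiForm_smul_left, h1]; simp

theorem NullStructure.mem_perp_iff {p : M} {k : CTangent p} (hk : k ∈ N.fiber p) (hk0 : k ≠ 0)
    (v : CTangent p) : v ∈ N.perp p ↔ g.form p v k = 0 := by
  refine ⟨fun h => h k hk, fun h w hw => ?_⟩
  obtain ⟨c, rfl⟩ := N.exists_smul_eq hk hk0 hw
  simp [h]

variable [IsManifold 𝓘(ℝ, E3) ∞ M]

/-- A generator of `N` is an eigenvector of the tracefree Ricci tensor with nonzero eigenvalue. -/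
theorem exists_tracefreeRicci_eigenvalue (hN : N.IsMultiplePrincipal)
    (hII : N.IsNondegenerateTypeII) (he : e ∈ atlas E3 M) {y : E3} (hy : y ∈ e.target)
    {k : CTangent (e.symm y)} (hk : k ∈ N.fiber _) (hk0 : k ≠ 0) :
    ∃ c : ℂ, c ≠ 0 ∧ (Matrix.of fun a b => tracefreeRicci (g.comp e) a b y) *ᵥ coords e _ k =
      c • g.comp e y *ᵥ coords e _ k := by
  have hp : e.symm y ∈ e.source := e.map_target hy
  have hG := isMetricOn_comp g he
  obtain ⟨l, n, hf, hΦkk, hΦkn⟩ := hN.exists_frame he hp hk hk0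
  obtain ⟨k', l', n', hf', hΦ'⟩ := hII _ e he hp
  set Φ : Matrix (Fin 3) (Fin 3) ℂ := Matrix.of fun a b => tracefreeRicci (g.comp e) a b y with hΦ
  have hΦt : Φᵀ = Φ := by
    ext a b; exact hG.tracefreeRicci_symm hy b a
  have key : Φ *ᵥ coords e _ k = phiForm g e _ k l • g.comp e y *ᵥ coords e _ k := by
    rw [phiForm_eq_dotProduct g hy] at hΦkk hΦkn ⊢
    obtain ⟨-, h1, h2, h3, h4, h5, h6⟩ := hf
    rw [form_eq_dotProduct g he hy] at h1 h2 h3 h4 h5 h6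
    have hinv := inverse_eq_of_frame (hG.transpose_eq y) h1 h2 h3 h4 h5 h6
    rw [← hΦ] at hΦkk hΦkn ⊢
    rw [dotProduct_mulVec_comm hΦt] at hΦkn ⊢
    set kk := coords e _ k
    set ll := coords e _ l
    set nn := coords e _ n
    -- Expand the vector obtained from Φ(k,·) by raising the index: its l- and n-coefficients are
    -- multiples of Φ₀ and Φ₁, so only a multiple of k survives.
    have e1 : (g.comp e y)⁻¹ *ᵥ (Φ *ᵥ kk) = (ll ⬝ᵥ Φ *ᵥ kk) • kk := by
      have e2 : (g.comp e y)⁻¹ *ᵥ (Φ *ᵥ kk) = (ll ⬝ᵥ Φ *ᵥ kk) • kk + (kk ⬝ᵥ Φ *ᵥ kk) • ll -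
          (2 * (nn ⬝ᵥ Φ *ᵥ kk)) • nn := by
        ext i
        simp only [mulVec, dotProduct, Fin.sum_univ_three, hinv, Pi.add_apply, Pi.sub_apply,
          Pi.smul_apply, smul_eq_mul]
        ring
      rw [e2, hΦkk, hΦkn]; simp
    rw [← mulVec_smul, ← e1, mulVec_mulVec, hG.mul_inv hy, one_mulVec]
  refine ⟨_, ?_, key⟩
  -- A zero eigenvalue would give Φk = 0 and hence Φ₂ = 0 in every adapted frame, since the
  -- generators of the line are proportional.
  intro h0
  apply hΦ'
  obtain ⟨c, rfl⟩ := N.exists_smul_eq hk hk0 hf'.mem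
  rw [phiTwo, phiForm_eq_dotProduct g hy, ← hΦ, dotProduct_mulVec_comm hΦt, coords_smul,
    mulVec_smul, key, h0]
  simp

/-- The core of the theorem: the covariant derivative of a local generator of `N` in directions of
`N^⊥` is orthogonal to `N^⊥`. -/
theorem metricCovDeriv_generator_eq_zero (hN : N.IsMultiplePrincipal)
    (hII : N.IsNondegenerateTypeII) (hA : N.SatisfiesTypeIICondition) {U : Set M} (hU : IsOpen U)
    {k : ∀ q : M, CTangent q} (hks : SmoothFieldOn U k)
    (hk : ∀ q ∈ U, k q ∈ N.fiber q ∧ k q ≠ 0) (he : e ∈ atlas E3 M) {p : M} (hpU : p ∈ U)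
    (hp : p ∈ e.source) {X Y : CTangent p} (hX : X ∈ N.perp p) (hY : Y ∈ N.perp p) :
    metricCovDeriv g e p X k Y = 0 := by
  obtain ⟨y, hy, rfl⟩ : ∃ y ∈ e.target, e.symm y = p :=
    ⟨e p, e.map_source hp, e.left_inv hp⟩
  have hG := isMetricOn_comp g he
  set G := g.comp e with hGdef
  set K := fieldComp e k with hKdef
  have hKc : ∀ x, coords e (e.symm x) (k (e.symm x)) = fun i => K i x := fun x => rfl
  set V₀ : Set E3 := e.target ∩ e.symm ⁻¹' U with hV₀
  have hV₀o : IsOpen V₀ := e.isOpen_inter_preimage_symm hU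
  have hKs₀ : ∀ i, ContDiffOn ℝ ∞ (K i) V₀ := fun i => hks e he i
  have hG₀ : IsMetricOn G V₀ := hG.mono hV₀o Set.inter_subset_left
  have eig : ∀ x ∈ V₀, ∃ c : ℂ, c ≠ 0 ∧ ∀ a, ∑ b, tracefreeRicci G a b x * K b x =
      c * ∑ b, G x a b * K b x := by
    intro x hx
    obtain ⟨c, hc, h⟩ := exists_tracefreeRicci_eigenvalue hN hII he hx.1 (hk _ hx.2).1 (hk _ hx.2).2
    exact ⟨c, hc, fun a => congrFun h a⟩
  have hy₀ : y ∈ V₀ := ⟨hy, hpU⟩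
  have hk0 := (hk _ hpU).2
  have hkm := (hk _ hpU).1
  -- a nonvanishing component of the dual one-form
  obtain ⟨i, hi⟩ : ∃ i, ∑ b, G y i b * K b y ≠ 0 := by
    by_contra! hcon
    have h1 : G y *ᵥ coords e _ (k (e.symm y)) = 0 := funext fun i => hcon i
    have h2 : coords e _ (k (e.symm y)) = 0 := by
      by_contra h3
      exact hG.det_ne_zero y hy (Matrix.exists_mulVec_eq_zero_iff.mp ⟨_, h3, h1⟩)
    apply hk0
    rw [← sum_coord_smul he hy (k (e.symm y))]
    exact Finset.sum_eq_zero fun i _ => by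
      rw [show coord e (e.symm y) i (k (e.symm y)) = 0 from congrFun h2 i, zero_smul]
  have hden : ContDiffOn ℝ ∞ (fun x => ∑ b, G x i b * K b x) V₀ :=
    ContDiffOn.sum fun b _ => (hG₀.smooth i b).mul (hKs₀ b)
  -- The eigenvalue is so far only known pointwise. Where the i-th component of the lowered
  -- generator is nonzero it is a quotient of smooth functions, hence differentiable.
  set V : Set E3 := V₀ ∩ (fun x => ∑ b, G x i b * K b x) ⁻¹' {0}ᶜ with hV
  have hVo : IsOpen V := hden.continuousOn.isOpen_inter_preimage hV₀o isOpen_compl_singleton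
  have hVV : V ⊆ V₀ := Set.inter_subset_left
  have hGV : IsMetricOn G V := hG₀.mono hVo hVV
  set φ : E3 → ℂ := fun x =>
    (∑ b, tracefreeRicci G i b x * K b x) * (∑ b, G x i b * K b x)⁻¹ with hφ
  have hφs : ContDiffOn ℝ ∞ φ V :=
    (ContDiffOn.sum fun b _ => (hGV.smooth_tracefreeRicci i b).mul ((hKs₀ b).mono hVV)).mul
      ((hden.mono hVV).inv fun x hx => hx.2)
  have eigφ : ∀ x ∈ V, φ x ≠ 0 ∧ ∀ a, ∑ b, tracefreeRicci G a b x * K b x =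
      φ x * ∑ b, G x a b * K b x := by
    intro x hx
    obtain ⟨c, hc, h⟩ := eig x (hVV hx)
    have hx2 : ∑ b, G x i b * K b x ≠ 0 := hx.2
    have : φ x = c := by simp only [hφ, h i]; field_simp
    rw [this]; exact ⟨hc, h⟩
  have hyV : y ∈ V := ⟨hy₀, hi⟩
  obtain ⟨l, n, hf, -, -⟩ := hN.exists_frame he hp hkm hk0
  have form_eq := form_eq_dotProduct g he hy
  have hsymm := hG.transpose_eq y
  rw [metricCovDeriv_eq_dotProduct g hy, ← dotProduct_mulVec_comm hsymm]
  obtain ⟨k', hk'm, hk'0, hcot⟩ := hA _ e he hp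
  -- The Cotton condition is given for some generator at the point; being homogeneous of degree two,
  -- it passes to the chosen one.
  obtain ⟨c, hc⟩ := N.exists_smul_eq hk'm hk'0 hkm
  refine hGV.metric_covDerivVec_eq_zero (k := coords e _ (k (e.symm y))) (l := coords e _ l)
    (n := coords e _ n) (fun i => (hKs₀ i).mono hVV) hφs (fun x hx => (eigφ x hx).2) ?_ hyV
    (eigφ y hyV).1 (fun _ => rfl) ?_ ?_ ?_ ?_ ?_ ?_ ?_ ?_
  · intro x hx
    have h1 := N.null _ _ (hk _ (hVV hx).2).1
    rw [form_eq_dotProduct g he (hVV hx).1] at h1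
    rw [← h1, hKc]
    simp only [mulVec, dotProduct, Finset.mul_sum]
    exact Finset.sum_congr rfl fun i _ => Finset.sum_congr rfl fun j _ => by ring
  · rw [← form_eq]; exact hf.ll
  · rw [← form_eq]; exact hf.kn
  · rw [← form_eq]; exact hf.ln
  · rw [← form_eq]; exact hf.kl
  · rw [← form_eq]; exact hf.nn
  · intro b
    have h1 := hcot b
    rw [e.right_inv hy] at h1
    rw [← hc, coords_smul, ← mul_zero (c ^ 2), ← h1]
    simp only [Finset.mul_sum]
    exact Finset.sum_congr rfl fun i _ => Finset.sum_congr rfl fun j _ => by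
      simp only [coords, Pi.smul_apply, smul_eq_mul]; ring
  · rw [dotProduct_mulVec_comm hsymm, ← form_eq]; exact hX _ hkm
  · rw [dotProduct_mulVec_comm hsymm, ← form_eq]; exact hY _ hkm

/-- The expression depends on Z only through its value at p, so Z may be replaced by a local
generator k. Differentiating g(Y,k) = 0 then gives g(∇_X Y, k) = -g(Y, ∇_X k), which vanishes by the
core statement. -/
theorem isCoGeodetic_of_typeII (hN : N.IsMultiplePrincipal)
    (hII : N.IsNondegenerateTypeII) (hA : N.SatisfiesTypeIICondition) : N.IsCoGeodetic := by
  intro U hU X Y Z _ hYs _ hX hY hZ p hpU e he hp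
  obtain ⟨U', hU', hpU', k, hks, hk⟩ := N.smooth p
  have hcore := metricCovDeriv_generator_eq_zero hN hII hA hU' hks hk he hpU' hp
    (hX p hpU) (hY p hpU)
  obtain ⟨c, hc⟩ := N.exists_smul_eq (hk p hpU').1 (hk p hpU').2 (hZ p hpU)
  rw [← hc]
  obtain ⟨y, hy, rfl⟩ : ∃ y ∈ e.target, e.symm y = p :=
    ⟨e p, e.map_source hp, e.left_inv hp⟩
  have hG := isMetricOn_comp g he
  set V : Set E3 := e.target ∩ e.symm ⁻¹' (U ∩ U') with hV
  have hVo : IsOpen V := e.isOpen_inter_preimage_symm (hU.inter hU')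
  have hGV := hG.mono hVo Set.inter_subset_left
  have hyV : y ∈ V := ⟨hy, hpU, hpU'⟩
  have h0 : ∀ x ∈ V, ∑ a, ∑ b, g.comp e x a b * fieldComp e Y a x * fieldComp e k b x = 0 := by
    intro x hx
    have h1 := hY _ hx.2.1 _ (hk _ hx.2.2).1
    rw [form_eq_dotProduct g he hx.1] at h1
    rw [← h1]
    simp only [mulVec, dotProduct, Finset.mul_sum]
    exact Finset.sum_congr rfl fun i _ => Finset.sum_congr rfl fun j _ => by
      simp only [coords, fieldComp]; ring
  have hYV : ∀ i, ContDiffOn ℝ ∞ (fieldComp e Y i) V := fun i =>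
    (hYs e he i).mono fun x hx => ⟨hx.1, hx.2.1⟩
  have hkV : ∀ i, ContDiffOn ℝ ∞ (fieldComp e k i) V := fun i =>
    (hks e he i).mono fun x hx => ⟨hx.1, hx.2.2⟩
  have key := hGV.pd_metric_apply hYV hkV h0 hyV (coords e _ (X (e.symm y)))
  rw [metricCovDeriv_eq_dotProduct g hy] at hcore ⊢
  rw [coords_smul, mulVec_smul, dotProduct_smul, smul_eq_mul]
  rw [← dotProduct_mulVec_comm (hG.transpose_eq y)] at hcore
  refine mul_eq_zero_of_right c ?_
  simp only [mulVec, dotProduct, Fin.sum_univ_three] at key hcore ⊢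
  simp only [coords, fieldComp] at key hcore ⊢
  linear_combination key - hcore

end NullStructures

end GoldbergSachs

/-! ### The theorem on the manifold -/

theorem mainTheorem5 {M : Type*} [TopologicalSpace M] [ChartedSpace GoldbergSachs.E3 M]
    [IsManifold 𝓘(ℝ, GoldbergSachs.E3) ∞ M]
    (g : GoldbergSachs.ComplexMetric M) (N : GoldbergSachs.NullStructure g)
    (hN : N.IsMultiplePrincipal) (hII : N.IsNondegenerateTypeII)
    (hA : N.SatisfiesTypeIICondition) :
    N.IsCoGeodetic ∧
      ∀ U : Set M, IsOpen U → ∀ k l n : ∀ q : M, GoldbergSachs.CTangent q,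
        GoldbergSachs.SmoothFieldOn U k → GoldbergSachs.SmoothFieldOn U l →
        GoldbergSachs.SmoothFieldOn U n → (∀ q ∈ U, N.IsAdaptedFrame q (k q) (l q) (n q)) →
        ∀ p ∈ U, ∀ e ∈ atlas GoldbergSachs.E3 M, p ∈ e.source →
          GoldbergSachs.kappa g e p k n = 0 ∧ GoldbergSachs.rho g e p k n = 0 := by
  refine ⟨GoldbergSachs.isCoGeodetic_of_typeII hN hII hA, ?_⟩
  intro U hU k l n hk _ _ hf p hp e he hpe
  have hn : n p ∈ N.perp p := by
    rw [GoldbergSachs.NullStructure.mem_perp_iff (hf p hp).mem (hf p hp).ne_zero,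
      ← (g.symm p).eq]
    exact (hf p hp).kn
  have hkp : k p ∈ N.perp p := by
    rw [GoldbergSachs.NullStructure.mem_perp_iff (hf p hp).mem (hf p hp).ne_zero]
    exact (hf p hp).kk
  -- Both κ and ρ are values of g(∇_X k, n), with X = k and X = n, and k and n are orthogonal to the
  -- null line.
  have key : ∀ X ∈ N.perp p, GoldbergSachs.metricCovDeriv g e p X k (n p) = 0 := fun X hX =>
    GoldbergSachs.metricCovDeriv_generator_eq_zero hN hII hA hU hk
      (fun q hq => ⟨(hf q hq).mem, (hf q hq).ne_zero⟩) he hp hpe hX hn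
  exact ⟨key _ hkp, key _ hn⟩
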